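/- **Setting.** A weighted digraph $G=(V,E,w)$ consists of a finite vertex set $V$, a set of edges $E\subseteq\{(i,j)\in V\times V: i\neq j\}$ and weights $w:E\to\mathbb R_{>0}$ (in the subdivided digraphs below, weight $0$ is also allowed). For vertices $i,j$ let $d(i,j)\in[0,\infty]$ be the minimal total weight of a directed path from $i$ to $j$ ($\infty$ if there is none). For $t\ge 0$ let $G^t$ be the digraph on $V$ with an edge $(i,j)$ whenever $i\ne j$ and $d(i,j)\le t$. For a digraph $D$ let $(\Omega_\bullet(D),\partial)$ be its regular path complex over $\mathbb R$: $\Omega_p(D)$ is the space of linear combinations $x$ of allowed $p$-paths $v_0\dots v_p$ (i.e. all $(v_{k},v_{k+1})$ are edges of $D$) such that $\partial x$ is a linear combination of allowed $(p-1)$-paths, where $\partial(v_0\dots v_p)=\sum_k(-1)^k v_0\dots\hat v_k\dots v_p$ with terms having two equal consecutive vertices set to $0$. The *grounded persistent path homology* of $G$ is the persistent vector space over $t\in[0,\infty)$ $$\mathcal H_1(G)(t)=\frac{\ker\big(\partial:\Omega_1(G\cup G^t)\to\Omega_0(G\cup G^t)\big)}{\partial\,\Omega_2(G^t)},$$ with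 maps induced by inclusion. Its barcode is the multiset of intervals $I\subseteq[0,\infty)$ in a decomposition of $\mathcal H_1(G)$ as a direct sum of interval modules. The bottleneck distance $d_B\in[0,\infty]$ of two barcodes is the infimum, over partial matchings of their intervals, of the largest of the $\ell^\infty$ distances between endpoint pairs (birth, death) of matched intervals and the numbers $(\text{death}-\text{birth})/2$ of unmatched intervals (deaths may be $\infty$, with $|\infty-\infty|=0$). **Theorem.** Let $G=(V,E,w)$ be a weighted digraph, $e=(a,b)\in E$, $n\ge 0$, and let $S=(S_0,\dots,S_n)$ with $S_i\ge 0$ and $\sum_i S_i=1$. Let $G_S$ be obtained from $G$ by replacing $e$ with $n+1$ daughter edges $\tau_i=(v_i,v_{i+1})$, $0\le i\le n$, of weight $S_i\,w(e)$, where $v_0=a$, $v_{n+1}=b$ and $v_1,\dots,v_n$ are new vertices. Let $G_e=(V,E\setminus\{e\},w)$, and let $d_e$ be the shortest-path distance in $G_e$. Fix any daughter edge $\tau=\tau_i$, and let $G_S\setminus\tau$ be $G_S$ with the edge $\tau$ deleted (all vertices being kept). Then $\mathcal H_1(G_S)$ and $\mathcal H_1(G_S\setminus\tau)$ have barcodes,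 and their barcodes satisfy $$d_B\big(\mathrm{Barcode}(\mathcal H_1(G_S)),\ \mathrm{Barcode}(\mathcal H_1(G_S\setminus\tau))\big)\ \le\ \max\Big(d_e(a,b),\ \frac{w(e)}{2}\Big)$$ (where the right-hand side is $\infty$ if $d_e(a,b)=\infty$). -/

import Mathlib

open scoped NNReal ENNReal DirectSum

/-! ## Weighted digraphs -/

/-- A digraph without self-loops on the vertex set `V`, with nonnegative edge weights. The values of
`weight` at pairs which are not edges carry no information: nothing below depends on them.
(Weight `0` is permitted since a subdivision may give a daughter edge a zero share; the weighted
digraphs one starts from satisfy `IsPositive`.) -/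
structure WeightedDigraph (V : Type*) extends Digraph V where
  loopless : ∀ v, ¬ Adj v v
  weight : V → V → ℝ
  weight_nonneg : ∀ u v, Adj u v → 0 ≤ weight u v

namespace WeightedDigraph

universe u

section Basic

variable {V : Type u}

/-- All edge weights are positive. -/
def IsPositive (G : WeightedDigraph V) : Prop :=
  ∀ u v, G.Adj u v → 0 < G.weight u v

/-- `G.IsPath i j l`: the list `l` is the sequence of vertices of a directed path from `i` to `j`
(consecutive vertices are joined by forward edges and no vertex is repeated). -/
def IsPath (G : WeightedDigraph V) (i j : V) (l : List V) : Prop :=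
  l.head? = some i ∧ l.getLast? = some j ∧ l.IsChain G.Adj ∧ l.Nodup

/-- The length of a path: the sum of the weights of its edges. -/
def pathLength (G : WeightedDigraph V) : List V → ℝ
  | [] => 0
  | [_] => 0
  | u :: v :: l => G.weight u v + pathLength G (v :: l)

/-- The shortest-path quasimetric; it is `∞` if there is no path. -/
noncomputable def dist (G : WeightedDigraph V) (i j : V) : ℝ≥0∞ :=
  ⨅ (l : List V) (_ : G.IsPath i j l), ENNReal.ofReal (G.pathLength l)

/-- The digraph `G^t` of the shortest-path filtration. -/
def sublevel (G : WeightedDigraph V) (t : ℝ≥0) : Digraph V where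
  Adj i j := i ≠ j ∧ G.dist i j ≤ t

/-- Deletion of the edge `(x, y)`. -/
def deleteEdge (G : WeightedDigraph V) (x y : V) : WeightedDigraph V where
  Adj u v := G.Adj u v ∧ (u, v) ≠ (x, y)
  loopless v h := G.loopless v h.1
  weight := G.weight
  weight_nonneg u v h := G.weight_nonneg u v h.1

end Basic

/-! ## Subdivision of one edge -/

section Subdivision

variable {V : Type u}

/-- The vertices `v_0 = a, v_1, …, v_n, v_{n+1} = b` along an edge `(a, b)` which is subdivided into
`n + 1` daughter edges; `v_1, …, v_n` are new. -/
def subdivVertex (a b : V) (n : ℕ) : Fin (n + 2) → V ⊕ Fin n :=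
  Fin.cons (Sum.inl a) (Fin.snoc (fun k => Sum.inr k) (Sum.inl b) : Fin (n + 1) → V ⊕ Fin n)

/-- The edges after subdivision of `(a, b)`: the old edges other than `(a, b)`, and the daughter
edges `τ_i = (v_i, v_{i+1})` (numbered from `0`). -/
inductive SubdivAdj (G : WeightedDigraph V) (a b : V) (n : ℕ) : V ⊕ Fin n → V ⊕ Fin n → Prop
  | old (u v : V) : G.Adj u v → (u, v) ≠ (a, b) →
      SubdivAdj G a b n (Sum.inl u) (Sum.inl v)
  | daughter (i : Fin (n + 1)) :
      SubdivAdj G a b n (subdivVertex a b n i.castSucc) (subdivVertex a b n i.succ)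

open Classical in
/-- The weights after subdivision: `S i * w (a, b)` for the daughter `τ_i` (whose index can be read
off from its initial vertex), the old weight for an old edge; see `subdivWeight_daughter` and
`subdivWeight_old`. -/
noncomputable def subdivWeight (G : WeightedDigraph V) (a b : V) (n : ℕ) (S : Fin (n + 1) → ℝ) :
    V ⊕ Fin n → V ⊕ Fin n → ℝ
  | Sum.inl u, Sum.inl v => if (u, v) = (a, b) then S 0 * G.weight a b else G.weight u v
  | Sum.inl _, Sum.inr _ => S 0 * G.weight a b
  | Sum.inr k, _ => S k.succ * G.weight a b

theorem subdivVertex_zero (a b : V) (n : ℕ) : subdivVertex a b n 0 = Sum.inl a := rfl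

theorem subdivVertex_last (a b : V) (n : ℕ) :
    subdivVertex a b n (Fin.last (n + 1)) = Sum.inl b := by
  rw [← Fin.succ_last]
  simp [subdivVertex]

theorem subdivVertex_new (a b : V) (n : ℕ) (k : Fin n) :
    subdivVertex a b n k.castSucc.succ = Sum.inr k := by
  simp [subdivVertex]

theorem subdivWeight_old (G : WeightedDigraph V) (a b : V) (n : ℕ) (S : Fin (n + 1) → ℝ) (u v : V)
    (h : (u, v) ≠ (a, b)) :
    G.subdivWeight a b n S (Sum.inl u) (Sum.inl v) = G.weight u v := by
  simp [subdivWeight, h]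

theorem subdivWeight_daughter (G : WeightedDigraph V) (a b : V) (n : ℕ) (S : Fin (n + 1) → ℝ)
    (i : Fin (n + 1)) :
    G.subdivWeight a b n S (subdivVertex a b n i.castSucc) (subdivVertex a b n i.succ)
      = S i * G.weight a b := by
  induction i using Fin.cases with
  | zero =>
    rw [Fin.castSucc_zero, subdivVertex_zero]
    cases n with
    | zero =>
      have h : subdivVertex a b 0 (Fin.succ 0) = Sum.inl b := subdivVertex_last a b 0
      rw [h]
      simp [subdivWeight]
    | succ m =>
      have h : subdivVertex a b (m + 1) (Fin.succ 0) = Sum.inr 0 := subdivVertex_new a b (m + 1) 0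
      rw [h]
      rfl
  | succ k =>
    rw [← Fin.succ_castSucc, subdivVertex_new]
    rfl

theorem not_subdivAdj_self (G : WeightedDigraph V) {a b : V} (hab : G.Adj a b) (n : ℕ)
    (x y : V ⊕ Fin n) (h : SubdivAdj G a b n x y) : x ≠ y := by
  cases h with
  | old u v h _ =>
    intro e
    obtain rfl := Sum.inl.inj e
    exact G.loopless _ h
  | daughter i =>
    induction i using Fin.cases with
    | zero =>
      rw [Fin.castSucc_zero, subdivVertex_zero]
      cases n with
      | zero =>
        have h : subdivVertex a b 0 (Fin.succ 0) = Sum.inl b := subdivVertex_last a b 0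
        rw [h]
        intro e
        obtain rfl := Sum.inl.inj e
        exact G.loopless _ hab
      | succ m =>
        have h : subdivVertex a b (m + 1) (Fin.succ 0) = Sum.inr 0 := subdivVertex_new a b (m + 1) 0
        rw [h]
        simp
    | succ k =>
      rw [← Fin.succ_castSucc, subdivVertex_new]
      cases n with
      | zero => exact k.elim0
      | succ m =>
        induction k using Fin.lastCases with
        | last =>
          rw [Fin.succ_last, Fin.succ_last, subdivVertex_last]
          simp
        | cast k =>
          rw [← Fin.castSucc_succ, subdivVertex_new]
          intro e
          have := congrArg Fin.val (Sum.inr.inj e)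
          simp at this

/-- Subdivision of the edge `(a, b)` into `n + 1` daughter edges `τ_0, …, τ_n`, where `τ_i` receives
the share `S i` of the weight, for a point `S` of the standard `n`-simplex. -/
noncomputable def subdivide (G : WeightedDigraph V) {a b : V} (hab : G.Adj a b) {n : ℕ}
    (S : stdSimplex ℝ (Fin (n + 1))) : WeightedDigraph (V ⊕ Fin n) where
  Adj := SubdivAdj G a b n
  loopless x h := not_subdivAdj_self G hab n x x h rfl
  weight := G.subdivWeight a b n S.1
  weight_nonneg x y h := by
    cases h with
    | old u v h h' =>
      rw [subdivWeight_old G a b n S.1 u v h']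
      exact G.weight_nonneg u v h
    | daughter i =>
      rw [subdivWeight_daughter]
      exact mul_nonneg (S.2.1 i) (G.weight_nonneg a b hab)

end Subdivision

end WeightedDigraph

/-! ## The regular path complex, with real coefficients -/

namespace PathHomology

universe u

variable {V : Type u}

/-- `Λ_p`: the real vector space freely generated by the elementary `p`-paths `v_0 … v_p`. -/
def Chain (V : Type u) (p : ℕ) : Type u := (Fin (p + 1) → V) →₀ ℝ

noncomputable instance (V : Type u) (p : ℕ) : AddCommGroup (Chain V p) :=
  inferInstanceAs (AddCommGroup ((Fin (p + 1) → V) →₀ ℝ))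

noncomputable instance (V : Type u) (p : ℕ) : Module ℝ (Chain V p) :=
  inferInstanceAs (Module ℝ ((Fin (p + 1) → V) →₀ ℝ))

/-- The standard basis of `Λ_p`, consisting of the elementary `p`-paths. -/
noncomputable def pathBasis (V : Type u) (p : ℕ) :
    Module.Basis (Fin (p + 1) → V) ℝ (Chain V p) :=
  .ofRepr (LinearEquiv.refl ℝ ((Fin (p + 1) → V) →₀ ℝ))

/-- Consecutive vertices are distinct. -/
def IsRegularPath {p : ℕ} (v : Fin (p + 1) → V) : Prop :=
  ∀ i : Fin p, v i.castSucc ≠ v i.succ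

/-- Consecutive vertices are joined by forward edges. -/
def IsAllowedPath (D : Digraph V) {p : ℕ} (v : Fin (p + 1) → V) : Prop :=
  ∀ i : Fin p, D.Adj (v i.castSucc) (v i.succ)

/-- The non-regular boundary `v_0 … v_p ↦ ∑ (-1)^i v_0 … v̂_i … v_p`. -/
noncomputable def nonregularBoundary (V : Type u) (p : ℕ) : Chain V (p + 1) →ₗ[ℝ] Chain V p :=
  (pathBasis V (p + 1)).constr ℝ fun v =>
    ∑ i : Fin (p + 2), (-1 : ℝ) ^ (i : ℕ) • pathBasis V p (fun k => v (i.succAbove k))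

open Classical in
/-- The projection `π` onto the span of the regular paths, which kills the non-regular ones. -/
noncomputable def regularProj (V : Type u) (p : ℕ) : Chain V p →ₗ[ℝ] Chain V p :=
  (pathBasis V p).constr ℝ fun v => if IsRegularPath v then pathBasis V p v else 0

/-- The regular boundary (only ever applied to combinations of regular paths). -/
noncomputable def boundary (V : Type u) (p : ℕ) : Chain V (p + 1) →ₗ[ℝ] Chain V p :=
  regularProj V p ∘ₗ nonregularBoundary V p

/-- `𝒜_p(D)`: the span of the allowed `p`-paths. -/
noncomputable def allowedChains (D : Digraph V) (p : ℕ) : Submodule ℝ (Chain V p) :=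
  Submodule.span ℝ {x | ∃ v, IsAllowedPath D v ∧ x = pathBasis V p v}

/-- `Ω_p(D)`: the `∂`-invariant `p`-paths. -/
noncomputable def invariantChains (D : Digraph V) : (p : ℕ) → Submodule ℝ (Chain V p)
  | 0 => allowedChains D 0
  | p + 1 => allowedChains D (p + 1) ⊓ (allowedChains D p).comap (boundary V p)

theorem allowedChains_mono {D D' : Digraph V} (h : ∀ u v, D.Adj u v → D'.Adj u v) (p : ℕ) :
    allowedChains D p ≤ allowedChains D' p := by
  refine Submodule.span_mono ?_
  rintro x ⟨v, hv, rfl⟩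
  exact ⟨v, fun i => h _ _ (hv i), rfl⟩

theorem invariantChains_mono {D D' : Digraph V} (h : ∀ u v, D.Adj u v → D'.Adj u v) (p : ℕ) :
    invariantChains D p ≤ invariantChains D' p := by
  cases p with
  | zero => exact allowedChains_mono h 0
  | succ p =>
    exact inf_le_inf (allowedChains_mono h _) (Submodule.comap_mono (allowedChains_mono h _))

end PathHomology

/-! ## Persistent vector spaces and barcodes -/

/-- A persistent real vector space, with parameter in `[0, ∞)`. -/
structure PersistentSpace where
  space : ℝ≥0 → Type*
  [addCommGroup : ∀ t, AddCommGroup (space t)]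
  [module : ∀ t, Module ℝ (space t)]
  map : ∀ {s t : ℝ≥0}, s ≤ t → space s →ₗ[ℝ] space t
  map_refl : ∀ (t : ℝ≥0) (x : space t), map le_rfl x = x
  map_map : ∀ {r s t : ℝ≥0} (hrs : r ≤ s) (hst : s ≤ t) (x : space r),
    map hst (map hrs x) = map (hrs.trans hst) x

attribute [instance] PersistentSpace.addCommGroup PersistentSpace.module

/-- A multiset of (nonempty) intervals of `[0, ∞)`, as a family indexed by a type. -/
structure Barcode where
  Feature : Type
  interval : Feature → Set ℝ≥0
  nonempty : ∀ i, (interval i).Nonempty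
  ordConnected : ∀ i, (interval i).OrdConnected

/-- The vector space at time `t` of the interval module `P(I)`: it is `ℝ` if `t ∈ I`, and `0`
otherwise. -/
def intervalSpace (I : Set ℝ≥0) (t : ℝ≥0) : Submodule ℝ ℝ where
  carrier := {x | t ∉ I → x = 0}
  add_mem' hx hy h := by rw [hx h, hy h, add_zero]
  zero_mem' _ := rfl
  smul_mem' c x hx h := by rw [hx h, smul_zero]

open Classical in
/-- The structure maps of the interval module `P(I)`: the identity if `s, t ∈ I`, and `0`
otherwise. -/
noncomputable def intervalMap (I : Set ℝ≥0) (s t : ℝ≥0) :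
    intervalSpace I s →ₗ[ℝ] intervalSpace I t where
  toFun x := ⟨if s ∈ I ∧ t ∈ I then (x : ℝ) else 0, fun h => if_neg fun h' => h h'.2⟩
  map_add' x y := by ext; by_cases h : s ∈ I ∧ t ∈ I <;> simp [h]
  map_smul' c x := by ext; by_cases h : s ∈ I ∧ t ∈ I <;> simp [h]

/-- `M ≅ ⨁ P(I)`, the sum being over the features of the barcode `B`. -/
def PersistentSpace.HasBarcode (M : PersistentSpace) (B : Barcode) : Prop :=
  ∃ φ : ∀ t : ℝ≥0, M.space t ≃ₗ[ℝ] ⨁ i : B.Feature, intervalSpace (B.interval i) t,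
    ∀ (s t : ℝ≥0) (h : s ≤ t) (x : M.space s) (i : B.Feature),
      φ t (M.map h x) i = intervalMap (B.interval i) s t (φ s x i)

namespace Barcode

/-- The left endpoint of a feature. -/
noncomputable def birth (B : Barcode) (i : B.Feature) : ℝ≥0∞ :=
  ⨅ t ∈ B.interval i, (t : ℝ≥0∞)

/-- The right endpoint of a feature, possibly `∞`. -/
noncomputable def death (B : Barcode) (i : B.Feature) : ℝ≥0∞ :=
  ⨆ t ∈ B.interval i, (t : ℝ≥0∞)

/-- `|x - y|` on `[0, ∞]`, with `|∞ - ∞| = 0` and `|x - ∞| = ∞` for finite `x`. -/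
noncomputable def absDiff (x y : ℝ≥0∞) : ℝ≥0∞ := max (x - y) (y - x)

/-- The `ℓ^∞` distance between the points of the persistence diagrams given by two features. -/
noncomputable def pairCost (B C : Barcode) (i : B.Feature) (j : C.Feature) : ℝ≥0∞ :=
  max (absDiff (B.birth i) (C.birth j)) (absDiff (B.death i) (C.death j))

/-- The `ℓ^∞` distance from the point of the persistence diagram given by a feature to the
diagonal. -/
noncomputable def diagonalCost (B : Barcode) (i : B.Feature) : ℝ≥0∞ :=
  (B.death i - B.birth i) / 2

/-- The cost of a partial matching `γ`: the supremum of the distances between matched points, and of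
the distances of the unmatched points (on either side) to the diagonal. -/
noncomputable def matchingCost (B C : Barcode) (γ : B.Feature ≃. C.Feature) : ℝ≥0∞ :=
  max (⨆ (i : B.Feature) (j : C.Feature) (_ : γ i = some j), pairCost B C i j)
    (max (⨆ (i : B.Feature) (_ : γ i = none), B.diagonalCost i)
      (⨆ (j : C.Feature) (_ : γ.symm j = none), C.diagonalCost j))

/-- The bottleneck distance between two barcodes. -/
noncomputable def bottleneckDist (B C : Barcode) : ℝ≥0∞ :=
  ⨅ γ : B.Feature ≃. C.Feature, matchingCost B C γ

end Barcode

/-! ## Maps between subquotients -/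

section Subquotient

variable {M : Type*} [AddCommGroup M] [Module ℝ M]

/-- The map `Z / B → Z' / B'` induced by inclusions `Z ⊆ Z'` and `B ⊆ B'`. -/
def subquotientMap {Z Z' B B' : Submodule ℝ M} (hZ : Z ≤ Z') (hB : B ≤ B') :
    (Z ⧸ B.submoduleOf Z) →ₗ[ℝ] (Z' ⧸ B'.submoduleOf Z') :=
  Submodule.mapQ _ _ (Submodule.inclusion hZ) (fun _ hx => hB hx)

theorem subquotientMap_mk {Z Z' B B' : Submodule ℝ M} (hZ : Z ≤ Z') (hB : B ≤ B') (x : Z) :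
    subquotientMap hZ hB (Submodule.Quotient.mk x)
      = Submodule.Quotient.mk (Submodule.inclusion hZ x) :=
  rfl

theorem subquotientMap_refl {Z B : Submodule ℝ M} (x : Z ⧸ B.submoduleOf Z) :
    subquotientMap le_rfl le_rfl x = x := by
  obtain ⟨x, rfl⟩ := Submodule.Quotient.mk_surjective _ x
  rfl

theorem subquotientMap_subquotientMap {Z Z' Z'' B B' B'' : Submodule ℝ M} (hZ : Z ≤ Z')
    (hB : B ≤ B') (hZ' : Z' ≤ Z'') (hB' : B' ≤ B'') (x : Z ⧸ B.submoduleOf Z) :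
    subquotientMap hZ' hB' (subquotientMap hZ hB x)
      = subquotientMap (hZ.trans hZ') (hB.trans hB') x := by
  obtain ⟨x, rfl⟩ := Submodule.Quotient.mk_surjective _ x
  rfl

end Subquotient

/-! ## Grounded persistent path homology -/

namespace WeightedDigraph

open PathHomology

universe u

variable {V : Type u}

/-- The cycles, in degree `1`, of the grounded complex
`⋯ → Ω_2(G^t) → Ω_1(G ∪ G^t) → Ω_0(G ∪ G^t)`. -/
noncomputable def groundedCycles (G : WeightedDigraph V) (t : ℝ≥0) : Submodule ℝ (Chain V 1) :=
  invariantChains (G.toDigraph ⊔ G.sublevel t) 1 ⊓ LinearMap.ker (boundary V 0)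

/-- The boundaries, in degree `1`, of the grounded complex
`⋯ → Ω_2(G^t) → Ω_1(G ∪ G^t) → Ω_0(G ∪ G^t)`. -/
noncomputable def groundedBoundaries (G : WeightedDigraph V) (t : ℝ≥0) :
    Submodule ℝ (Chain V 1) :=
  (invariantChains (G.sublevel t) 2).map (boundary V 1)

/-- The grounded homology in degree `1` at time `t`: cycles modulo boundaries. -/
abbrev GroundedHomology (G : WeightedDigraph V) (t : ℝ≥0) : Type u :=
  G.groundedCycles t ⧸ (G.groundedBoundaries t).submoduleOf (G.groundedCycles t)

theorem sublevel_mono (G : WeightedDigraph V) {s t : ℝ≥0} (h : s ≤ t) (u v : V)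
    (huv : (G.sublevel s).Adj u v) : (G.sublevel t).Adj u v :=
  ⟨huv.1, huv.2.trans (ENNReal.coe_le_coe.2 h)⟩

theorem groundedCycles_mono (G : WeightedDigraph V) {s t : ℝ≥0} (h : s ≤ t) :
    G.groundedCycles s ≤ G.groundedCycles t := by
  refine inf_le_inf (invariantChains_mono ?_ 1) le_rfl
  rintro u v (huv | huv)
  · exact Or.inl huv
  · exact Or.inr (G.sublevel_mono h u v huv)

theorem groundedBoundaries_mono (G : WeightedDigraph V) {s t : ℝ≥0} (h : s ≤ t) :
    G.groundedBoundaries s ≤ G.groundedBoundaries t :=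
  Submodule.map_mono (invariantChains_mono (G.sublevel_mono h) 2)

/-- Grounded persistent path homology, in degree `1`; the maps are induced by the inclusions
`G^s ⊆ G^t` and `G ∪ G^s ⊆ G ∪ G^t`. -/
noncomputable def groundedPersistentHomology (G : WeightedDigraph V) : PersistentSpace.{u} where
  space t := G.GroundedHomology t
  map h := subquotientMap (G.groundedCycles_mono h) (G.groundedBoundaries_mono h)
  map_refl _ x := subquotientMap_refl x
  map_map hrs hst x :=
    subquotientMap_subquotientMap (G.groundedCycles_mono hrs) (G.groundedBoundaries_mono hrs)
      (G.groundedCycles_mono hst) (G.groundedBoundaries_mono hst) x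

end WeightedDigraph

/-! Let H be the subdivided digraph and H' the result of deleting τ from it. Write Z, Z' for their
directed cycle spaces, B_t, B'_t for their grounded boundaries, and d for d_e(a,b), which may be
assumed finite.

Modulo B_t, each edge of H^t equals a walk in H of length at most t, by a fan of triangles. So the
homology at time t is Z / (Z ∩ B_t) (`groundedCycles_le`, `cyclePresentation`), a quotient of a
fixed finite-dimensional space that shrinks as t grows. A basis adapted to the nested kernels gives
a barcode (`exists_hasBarcode`). In any barcode all bars start at 0, and the bars are determined by
the dimension function (`isCounted`, `exists_sorted`). The theorem thus reduces to comparing the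
dimension functions f of H and g of H' (`bottleneckDist_le_of_isCounted`).

The comparison goes through h(t) = dim Z' - dim (Z' ∩ B_t). Since Z' is the hyperplane of Z where
the coefficient of τ vanishes, f = h + 1 as long as every cycle in B_t avoids τ, and f = h
afterwards. The cycle formed by the subdivided edge and a bypass is a boundary by time max(d, w(e)),
so the extra bar costs at most max(d, w(e))/2 (`exists_cycle_mem_groundedBoundaries`).

It remains to see that g(t + d) ≤ h(t) ≤ g(t). The right inequality is B'_t ⊆ B_t. For the left one,
collapse the daughters before τ to a and those after it to b. This retraction fixes every cycle of
H', by a chain homotopy (`pushforward_eq_self`). It carries pairs at distance at most t in H to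
pairs at distance at most t + d in H', since the crossings of τ can be replaced by a single bypass
(`dist_retract_le`). Hence Z' ∩ B_t ⊆ B'_{t+d} (`mem_groundedBoundaries_deleteEdge`). -/

/-! ## Bases adapted to a chain of subspaces -/

section AdaptedBasis

variable {N : Type*} [AddCommGroup N] [Module ℝ N]

/-- Induction on dimension: below `W` the chain has a largest proper member, which contains all the
others. An independent set adapted inside it extends to one spanning `W`, and the extension cannot
spoil the smaller members. -/
theorem exists_linearIndepOn_adapted [FiniteDimensional ℝ N] (k : ℕ) :
    ∀ (W : Submodule ℝ N) (C : Set (Submodule ℝ N)), Module.finrank ℝ W ≤ k →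
      IsChain (· ≤ ·) C → (∀ c ∈ C, c ≤ W) →
      ∃ s : Set N, LinearIndepOn ℝ id s ∧ Submodule.span ℝ s = W ∧
        ∀ c ∈ C, c ≤ Submodule.span ℝ (s ∩ c) := by
  induction k with
  | zero =>
    intro W C hW _ hCW
    have hW0 : W = ⊥ := Submodule.finrank_eq_zero.1 (Nat.le_zero.1 hW)
    refine ⟨∅, linearIndepOn_empty ℝ id, by simp [hW0], fun c hc => ?_⟩
    rw [hW0] at hCW
    exact (hCW c hc).trans bot_le
  | succ k ih =>
    intro W C hW hC hCW
    -- `W'` is the largest member of `C` other than `W`, or `⊥` if there is none; the alternative `W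
    -- = ⊥` covers the case where no smaller subspace exists.
    obtain ⟨W', hW', hlt, hC'⟩ : ∃ W' : Submodule ℝ N, W' ≤ W ∧ (W = ⊥ ∨ W' < W) ∧
        ∀ c ∈ C, c ≠ W → c ≤ W' := by
      by_cases h : {c ∈ C | c ≠ W}.Nonempty
      · obtain ⟨M, hM, hmax⟩ := wellFounded_gt.has_min {c ∈ C | c ≠ W} h
        refine ⟨M, hCW M hM.1, Or.inr (lt_of_le_of_ne (hCW M hM.1) hM.2), fun c hc hcW => ?_⟩
        rcases hC.total hc hM.1 with h | h
        · exact h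
        · exact (eq_or_lt_of_le h).elim (fun h => h.ge) fun h => absurd h (hmax c ⟨hc, hcW⟩)
      · refine ⟨⊥, bot_le, ?_, fun c hc hcW => absurd ⟨c, hc, hcW⟩ h⟩
        exact (eq_or_ne W ⊥).imp_right bot_lt_iff_ne_bot.2
    have hfin : Module.finrank ℝ W' ≤ k := by
      rcases hlt with h | h
      · rw [h, le_bot_iff] at hW'
        rw [hW', finrank_bot]
        exact zero_le
      · have := Submodule.finrank_lt_finrank_of_lt h
        omega
    obtain ⟨s, hs, hsW, hsC⟩ := ih W' {c ∈ C | c ≠ W} hfin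
      (hC.mono fun c hc => hc.1) fun c hc => hC' c hc.1 hc.2
    obtain ⟨b, hbW, hsb, hspan, hb⟩ := exists_linearIndepOn_id_extension (t := (W : Set N)) hs
      (fun x hx => hW' (hsW ▸ Submodule.subset_span hx))
    have hspan' : Submodule.span ℝ b = W := le_antisymm (Submodule.span_le.2 hbW) hspan
    refine ⟨b, hb, hspan', fun c hc => ?_⟩
    by_cases hcW : c = W
    · rw [hcW, Set.inter_eq_left.2 hbW, hspan']
    · exact (hsC c ⟨hc, hcW⟩).trans (Submodule.span_mono (Set.inter_subset_inter_left _ hsb))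

/-- Every member of the chain is spanned by the basis vectors it contains, so membership can be read
off coordinates. This is the form needed to compare kernels below. -/
theorem exists_basis_adapted [FiniteDimensional ℝ N] {C : Set (Submodule ℝ N)}
    (hC : IsChain (· ≤ ·) C) :
    ∃ (m : ℕ) (b : Module.Basis (Fin m) ℝ N), ∀ c ∈ C, ∀ z : N,
      z ∈ c ↔ ∀ i, b i ∉ c → b.repr z i = 0 := by
  obtain ⟨s, hs, hspan, hsC⟩ := exists_linearIndepOn_adapted _ ⊤ C le_rfl hC fun _ _ => le_top
  let b₀ : Module.Basis s ℝ N := .mk (v := fun x : s => (x : N)) hs (by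
    rw [Subtype.range_coe, hspan])
  have : Finite s := hs.finite
  let b := b₀.reindex (Finite.equivFin s)
  refine ⟨_, b, fun c hc z => ⟨fun hz i hi => ?_, fun hz => ?_⟩⟩
  · have hsub : s ∩ c ⊆ b '' {i | b i ∈ c} := by
      rintro x ⟨hx, hxc⟩
      have hbx : b (Finite.equivFin s ⟨x, hx⟩) = x :=
        (b₀.reindex_apply _ _).trans (by
          rw [Equiv.symm_apply_apply]
          exact Module.Basis.mk_apply _ _ _)
      exact ⟨_, by rwa [Set.mem_ofPred_eq, hbx], hbx⟩
    have h := Submodule.span_mono hsub (hsC c hc hz)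
    rw [b.mem_span_image] at h
    by_contra hne
    exact hi (h (Finsupp.mem_support_iff.2 hne))
  · rw [← b.sum_repr z]
    refine Submodule.sum_mem _ fun i _ => ?_
    by_cases hi : b i ∈ c
    · exact c.smul_mem _ hi
    · rw [hz i hi, zero_smul]
      exact c.zero_mem

end AdaptedBasis

/-! ## Persistent spaces all of whose structure maps are surjective -/

namespace PersistentSpace

/-- A compatible family of surjections from a fixed vector space onto the spaces of `P`. -/
structure Presentation (P : PersistentSpace) (N : Type*) [AddCommGroup N] [Module ℝ N] where
  proj : ∀ t, N →ₗ[ℝ] P.space t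
  surjective : ∀ t, Function.Surjective (proj t)
  map_proj : ∀ {s t : ℝ≥0} (h : s ≤ t) (x : N), P.map h (proj s x) = proj t x

open Classical in
/-- The projection of `ℝ` onto the vector space at time `t` of the interval module `P(I)`. -/
noncomputable def intervalProj (I : Set ℝ≥0) (t : ℝ≥0) : ℝ →ₗ[ℝ] intervalSpace I t where
  toFun x := ⟨if t ∈ I then x else 0, fun h => if_neg h⟩
  map_add' x y := by ext; by_cases h : t ∈ I <;> simp [h]
  map_smul' c x := by ext; by_cases h : t ∈ I <;> simp [h]

theorem intervalProj_of_mem {I : Set ℝ≥0} {t : ℝ≥0} (h : t ∈ I) (x : ℝ) :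
    (intervalProj I t x : ℝ) = x := if_pos h

theorem intervalProj_of_notMem {I : Set ℝ≥0} {t : ℝ≥0} (h : t ∉ I) (x : ℝ) :
    (intervalProj I t x : ℝ) = 0 := if_neg h

theorem intervalMap_of_mem {I : Set ℝ≥0} {s t : ℝ≥0} (hs : s ∈ I) (ht : t ∈ I)
    (x : intervalSpace I s) : (intervalMap I s t x : ℝ) = x := if_pos ⟨hs, ht⟩

theorem intervalMap_of_notMem {I : Set ℝ≥0} {s t : ℝ≥0} (h : ¬ (s ∈ I ∧ t ∈ I))
    (x : intervalSpace I s) : (intervalMap I s t x : ℝ) = 0 := if_neg h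

/-- Two surjections with the same kernel have isomorphic targets. -/
theorem _root_.LinearMap.exists_equiv_of_ker_eq {N P Q : Type*} [AddCommGroup N] [Module ℝ N]
    [AddCommGroup P] [Module ℝ P] [AddCommGroup Q] [Module ℝ Q] (f : N →ₗ[ℝ] P) (g : N →ₗ[ℝ] Q)
    (hf : Function.Surjective f) (hg : Function.Surjective g)
    (h : LinearMap.ker f = LinearMap.ker g) : ∃ φ : P ≃ₗ[ℝ] Q, ∀ x, φ (f x) = g x := by
  refine ⟨(f.quotKerEquivOfSurjective hf).symm ≪≫ₗ Submodule.quotEquivOfEq _ _ h ≪≫ₗ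
    g.quotKerEquivOfSurjective hg, fun x => ?_⟩
  have : (f.quotKerEquivOfSurjective hf).symm (f x) = Submodule.Quotient.mk x := by
    rw [LinearEquiv.symm_apply_eq]
    rfl
  simp only [LinearEquiv.trans_apply, this]
  rfl

namespace Presentation

variable {P : PersistentSpace} {N : Type*} [AddCommGroup N] [Module ℝ N]

theorem ker_mono (π : P.Presentation N) {s t : ℝ≥0} (h : s ≤ t) :
    LinearMap.ker (π.proj s) ≤ LinearMap.ker (π.proj t) := fun x hx => by
  rw [LinearMap.mem_ker] at hx ⊢
  rw [← π.map_proj h, hx, map_zero]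

/-- Take a basis of `N` adapted to the increasing kernels. Each basis vector yields a bar lasting
until the vector enters the kernel; vectors already killed at time 0 are discarded, since bars must
be nonempty. The sum of these interval modules is a quotient of `N` with the same kernels, hence
isomorphic to `P`. -/
theorem exists_hasBarcode [FiniteDimensional ℝ N] (π : P.Presentation N) :
    ∃ B : Barcode, P.HasBarcode B := by
  classical
  obtain ⟨m, b, hb⟩ := exists_basis_adapted
    (C := Set.range fun t => LinearMap.ker (π.proj t)) (by
      rintro _ ⟨s, rfl⟩ _ ⟨t, rfl⟩ _
      exact (le_total s t).imp π.ker_mono π.ker_mono)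
  let B : Barcode :=
    { Feature := {i : Fin m // b i ∉ LinearMap.ker (π.proj 0)}
      interval := fun i => {t | b i ∉ LinearMap.ker (π.proj t)}
      nonempty := fun i => ⟨0, i.2⟩
      ordConnected := fun i => ⟨fun s _ t ht r hr h => ht (π.ker_mono hr.2 h)⟩ }
  have : Fintype B.Feature := inferInstanceAs (Fintype {i : Fin m // _})
  let ψ : ∀ t, N →ₗ[ℝ] ⨁ i : B.Feature, intervalSpace (B.interval i) t := fun t =>
    (DirectSum.linearEquivFunOnFintype ℝ B.Feature
      (fun i => intervalSpace (B.interval i) t)).symm.toLinearMap ∘ₗ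
      LinearMap.pi fun i => intervalProj (B.interval i) t ∘ₗ b.coord i.1
  have hψ : ∀ t z i, ψ t z i = intervalProj (B.interval i) t (b.repr z i.1) := by
    intro t z i
    exact congrFun ((DirectSum.linearEquivFunOnFintype ℝ B.Feature
      (fun i => intervalSpace (B.interval i) t)).apply_symm_apply
      fun i => intervalProj (B.interval i) t (b.repr z i.1)) i
  have hker : ∀ t, LinearMap.ker (π.proj t) = LinearMap.ker (ψ t) := by
    intro t
    ext z
    rw [hb _ ⟨t, rfl⟩ z, LinearMap.mem_ker]
    constructor
    · intro h
      refine DFinsupp.ext fun i => Subtype.ext ?_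
      rw [hψ]
      by_cases ht : t ∈ B.interval i
      · rw [intervalProj_of_mem ht, h _ ht]
        rfl
      · exact intervalProj_of_notMem ht _
    · intro h i hi
      have hi₀ : b i ∉ LinearMap.ker (π.proj 0) := fun h => hi (π.ker_mono zero_le h)
      rw [← intervalProj_of_mem (I := B.interval ⟨i, hi₀⟩) (t := t) hi (b.repr z i),
        ← hψ t z ⟨i, hi₀⟩, h]
      rfl
  have hsurj : ∀ t, Function.Surjective (ψ t) := by
    intro t y
    refine ⟨b.equivFun.symm fun i => if h : b i ∉ LinearMap.ker (π.proj 0) then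
      ((y (⟨i, h⟩ : B.Feature) : ℝ)) else 0, DFinsupp.ext fun i => Subtype.ext ?_⟩
    rw [hψ, ← b.equivFun_apply, LinearEquiv.apply_symm_apply, dif_pos i.2]
    by_cases ht : t ∈ B.interval i
    · rw [intervalProj_of_mem ht]
    · rw [intervalProj_of_notMem ht]
      exact ((y i).2 ht).symm
  choose φ hφ using fun t => LinearMap.exists_equiv_of_ker_eq (π.proj t) (ψ t) (π.surjective t)
    (hsurj t) (hker t)
  refine ⟨B, φ, fun s t h x i => Subtype.ext ?_⟩
  obtain ⟨z, rfl⟩ := π.surjective s x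
  rw [π.map_proj, hφ, hφ, hψ, hψ]
  by_cases ht : t ∈ B.interval i
  · have hs : s ∈ B.interval i := fun h' => ht (π.ker_mono h h')
    rw [intervalMap_of_mem hs ht, intervalProj_of_mem ht, intervalProj_of_mem hs]
  · rw [intervalMap_of_notMem fun h => ht h.2, intervalProj_of_notMem ht]

end Presentation

end PersistentSpace

/-! ## Barcodes of initial intervals -/

namespace Barcode

/-- `B` has finitely many features, all born at time `0`, of which `f t` are alive at time `t`. -/
structure IsCounted (B : Barcode) (f : ℝ≥0 → ℕ) : Prop where
  finite : Finite B.Feature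
  zero_mem : ∀ i, 0 ∈ B.interval i
  card : ∀ t, Nat.card {i // t ∈ B.interval i} = f t

theorem finrank_intervalSpace_of_mem {I : Set ℝ≥0} {t : ℝ≥0} (h : t ∈ I) :
    Module.finrank ℝ (intervalSpace I t) = 1 := by
  have : intervalSpace I t = ⊤ := eq_top_iff.2 fun x _ h' => absurd h h'
  rw [this, finrank_top, Module.finrank_self]

theorem finrank_intervalSpace_of_notMem {I : Set ℝ≥0} {t : ℝ≥0} (h : t ∉ I) :
    Module.finrank ℝ (intervalSpace I t) = 0 := by
  have : intervalSpace I t = ⊥ := eq_bot_iff.2 fun x hx => hx h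
  rw [this, finrank_bot]

/-- This applies to every barcode of `P`, not only the one constructed above, so the final bound
does not rest on uniqueness of barcodes. -/
theorem _root_.PersistentSpace.Presentation.isCounted {P : PersistentSpace} {N : Type*}
    [AddCommGroup N] [Module ℝ N] [FiniteDimensional ℝ N] (π : P.Presentation N) {B : Barcode}
    (hB : P.HasBarcode B) : B.IsCounted fun t => Module.finrank ℝ (P.space t) := by
  classical
  obtain ⟨φ, hφ⟩ := hB
  have hfd : ∀ t, FiniteDimensional ℝ (P.space t) := fun t =>
    Module.Finite.of_surjective (π.proj t) (π.surjective t)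
  -- A bar absent at 0 but present at `t` would have a generator at `t` which lifts to time 0 by
  -- surjectivity, yet the interval map out of time 0 vanishes.
  have hzero : ∀ i, 0 ∈ B.interval i := by
    intro i
    by_contra h0
    obtain ⟨t, ht⟩ := B.nonempty i
    obtain ⟨z, hz⟩ := π.surjective t ((φ t).symm
      (DirectSum.lof ℝ B.Feature (fun i => intervalSpace (B.interval i) t) i
        ⟨1, fun h => absurd ht h⟩))
    have h := hφ 0 t zero_le (π.proj 0 z) i
    rw [π.map_proj, hz, LinearEquiv.apply_symm_apply, DirectSum.lof_apply] at h
    have h' := congrArg Subtype.val h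
    rw [PersistentSpace.intervalMap_of_notMem fun h => h0 h.1] at h'
    exact one_ne_zero h'
  -- Each bar contributes an independent vector at time 0, where the space is finite-dimensional.
  have hfin : Finite B.Feature := by
    have : FiniteDimensional ℝ (⨁ i : B.Feature, intervalSpace (B.interval i) 0) :=
      Module.Finite.equiv (φ 0)
    let v : B.Feature → ⨁ i : B.Feature, intervalSpace (B.interval i) 0 := fun i =>
      DirectSum.lof ℝ B.Feature (fun i => intervalSpace (B.interval i) 0) i
        ⟨1, fun h => absurd (hzero i) h⟩
    have hv : LinearIndependent ℝ v := by
      rw [linearIndependent_iff']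
      intro s g hg i hi
      have h := congrArg (fun x => ((DirectSum.component ℝ B.Feature
        (fun i => intervalSpace (B.interval i) 0) i x : intervalSpace (B.interval i) 0) : ℝ)) hg
      simp only [map_sum, map_smul, map_zero] at h
      rw [Finset.sum_eq_single_of_mem i hi] at h
      · simpa [v, DirectSum.component.lof_self] using h
      · intro j _ hji
        rw [DirectSum.component.of, dif_neg hji, smul_zero]
    exact hv.finite
  refine ⟨hfin, hzero, fun t => ?_⟩
  have : Fintype B.Feature := Fintype.ofFinite _
  rw [LinearEquiv.finrank_eq (φ t), Module.finrank_directSum, Nat.card_eq_fintype_card,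
    Fintype.card_subtype, Finset.card_filter]
  refine Finset.sum_congr rfl fun i _ => ?_
  split_ifs with h
  · exact (finrank_intervalSpace_of_mem h).symm
  · exact (finrank_intervalSpace_of_notMem h).symm

theorem mem_iff_lt_card_of_isLowerSet {p : ℕ} {s : Finset (Fin p)}
    (hs : IsLowerSet (s : Set (Fin p))) (k : Fin p) : k ∈ s ↔ (k : ℕ) < s.card := by
  constructor
  · intro hk
    have h : Finset.Iic k ⊆ s := fun j hj => hs (Finset.mem_Iic.1 hj) hk
    have := Finset.card_le_card h
    rw [Fin.card_Iic] at this
    omega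
  · intro hk
    by_contra hks
    have h : s ⊆ Finset.Iio k := fun j hj =>
      Finset.mem_Iio.2 (lt_of_not_ge fun hkj => hks (hs hkj hj))
    have := Finset.card_le_card h
    rw [Fin.card_Iio] at this
    omega

/-- A finite family of initial intervals is determined, up to reindexing, by the number of intervals
which contain any given time. -/
theorem exists_sorted {F : Type*} [Finite F] (I : F → LowerSet ℝ≥0) (h0 : ∀ i, 0 ∈ I i)
    {f : ℝ≥0 → ℕ} (hf : ∀ t, Nat.card {i // t ∈ I i} = f t) :
    ∃ e : Fin (f 0) ≃ F, ∀ k t, t ∈ I (e k) ↔ (k : ℕ) < f t := by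
  classical
  have hcard : Nat.card F = f 0 := by
    rw [← hf 0]
    exact Nat.card_congr (Equiv.subtypeUnivEquiv h0).symm
  obtain ⟨e₀⟩ : Nonempty (Fin (f 0) ≃ F) := ⟨(Finite.equivFinOfCardEq hcard).symm⟩
  -- Lower sets of `ℝ≥0` are linearly ordered by inclusion; the order dual puts the longest bars
  -- first, so the bars alive at `t` form an initial segment of indices.
  let e := (Tuple.sort fun k => OrderDual.toDual (I (e₀ k))).trans e₀
  have hanti : ∀ j k, j ≤ k → I (e k) ≤ I (e j) := fun j k hjk =>
    Tuple.monotone_sort (fun k => OrderDual.toDual (I (e₀ k))) hjk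
  refine ⟨e, fun k t => ?_⟩
  have h := mem_iff_lt_card_of_isLowerSet (s := {k | t ∈ I (e k)})
    (fun k j hjk hk => by
      rw [Finset.coe_filter] at hk ⊢
      exact ⟨Finset.mem_univ _, hanti j k hjk hk.2⟩) k
  rw [Finset.mem_filter_univ] at h
  rw [h, ← Fintype.card_subtype, ← Nat.card_eq_fintype_card, ← hf t,
    Nat.card_congr (e.subtypeEquiv (p := fun k => t ∈ I (e k)) (q := fun i => t ∈ I i)
      fun k => Iff.rfl)]

theorem exists_equiv_of_card_eq {F F' : Type*} [Finite F] [Finite F'] (I : F → LowerSet ℝ≥0)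
    (I' : F' → LowerSet ℝ≥0) (h0 : ∀ i, 0 ∈ I i) (h0' : ∀ i, 0 ∈ I' i)
    (h : ∀ t, Nat.card {i // t ∈ I i} = Nat.card {i // t ∈ I' i}) :
    ∃ e : F ≃ F', ∀ i t, t ∈ I' (e i) ↔ t ∈ I i := by
  obtain ⟨e, he⟩ := exists_sorted I h0 h
  obtain ⟨e', he'⟩ := exists_sorted I' h0' fun _ => rfl
  refine ⟨e.symm.trans e', fun i t => ?_⟩
  rw [Equiv.trans_apply, he', ← he, Equiv.apply_symm_apply]

/-- The interval of a feature of a barcode all of whose features are born at time `0`. -/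
def IsCounted.lowerSet {B : Barcode} {f : ℝ≥0 → ℕ} (hB : B.IsCounted f) (i : B.Feature) :
    LowerSet ℝ≥0 where
  carrier := B.interval i
  lower' _ _ hts ht := (B.ordConnected i).out (hB.zero_mem i) ht ⟨zero_le, hts⟩

theorem IsCounted.birth_eq_zero {B : Barcode} {f : ℝ≥0 → ℕ} (hB : B.IsCounted f)
    (i : B.Feature) : B.birth i = 0 :=
  le_antisymm (iInf₂_le 0 (hB.zero_mem i)) zero_le

/-- Births agree, so only deaths matter, and shifting points of the longer bar back by `d` bounds
their difference. -/
theorem IsCounted.pairCost_le {B C : Barcode} {f g : ℝ≥0 → ℕ} (hB : B.IsCounted f)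
    (hC : C.IsCounted g) {i : B.Feature} {j : C.Feature} (hij : B.interval i ⊆ C.interval j)
    {d : ℝ≥0} (hd : ∀ t, t + d ∈ C.interval j → t ∈ B.interval i) : pairCost B C i j ≤ d := by
  have h1 : B.death i ≤ C.death j := biSup_mono hij
  have h2 : C.death j ≤ d + B.death i := by
    refine iSup₂_le fun t ht => ?_
    rcases le_total t d with htd | htd
    · exact (ENNReal.coe_le_coe.2 htd).trans le_self_add
    · have hmem : t - d ∈ B.interval i := hd _ (by rwa [tsub_add_cancel_of_le htd])
      have h3 : ((t - d : ℝ≥0) : ℝ≥0∞) ≤ B.death i :=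
        le_iSup₂ (f := fun (t : ℝ≥0) (_ : t ∈ B.interval i) => (t : ℝ≥0∞)) (t - d) hmem
      calc (t : ℝ≥0∞) = d + (t - d : ℝ≥0) := by
            rw [← ENNReal.coe_add, add_tsub_cancel_of_le htd]
        _ ≤ d + B.death i := by gcongr
  simp only [pairCost, absDiff, hB.birth_eq_zero, hC.birth_eq_zero, tsub_self, max_self,
    tsub_eq_zero_of_le h1]
  simpa [tsub_le_iff_right] using h2

theorem diagonalCost_le (B : Barcode) (i : B.Feature) {m : ℝ≥0} (h : ∀ t ∈ B.interval i, t ≤ m) :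
    B.diagonalCost i ≤ (m : ℝ≥0∞) / 2 :=
  ENNReal.div_le_div_right (tsub_le_self.trans
    (iSup₂_le fun t ht => ENNReal.coe_le_coe.2 (h t ht))) 2

theorem card_subtype_sum {α β : Type*} [Finite α] [Finite β] (p : α ⊕ β → Prop) :
    Nat.card {x // p x} = Nat.card {x // p (Sum.inl x)} + Nat.card {x // p (Sum.inr x)} := by
  rw [Nat.card_congr (Equiv.subtypeSum (p := p)), Nat.card_sum]

theorem card_fin_lt {p q : ℕ} (h : q ≤ p) : Nat.card {k : Fin p // (k : ℕ) < q} = q := by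
  have e : {k : Fin p // (k : ℕ) < q} ≃ Fin q :=
    { toFun := fun k => ⟨k.1, k.2⟩
      invFun := fun k => ⟨⟨k, k.2.trans_le h⟩, k.2⟩
      left_inv := fun _ => rfl
      right_inv := fun _ => rfl }
  rw [Nat.card_congr e, Nat.card_fin]

/-- If, after removing one bar `U` from `B`, the barcodes `B` and `C` are `d`-close (in terms of the
numbers of bars alive), then `B` and `C` are close. -/
theorem bottleneckDist_le_of_isCounted {B C : Barcode} {f g h : ℝ≥0 → ℕ} (hB : B.IsCounted f)
    (hC : C.IsCounted g) (U : LowerSet ℝ≥0) {d m : ℝ≥0} (hU : ∀ t ∈ U, t ≤ m)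
    (hh : Antitone h) (hfU : ∀ t ∈ U, f t = h t + 1) (hfU' : ∀ t ∉ U, f t = h t)
    (hg : ∀ t, h t ≤ g t) (hgd : ∀ t, g (t + d) ≤ h t) :
    bottleneckDist B C ≤ max (d : ℝ≥0∞) (m / 2) := by
  classical
  have := hB.finite
  have := hC.finite
  have hganti : Antitone g := by
    intro s t hst
    rw [← hC.card, ← hC.card]
    exact Nat.card_le_card_of_injective
      (Subtype.map id fun j hj => (hC.lowerSet j).lower hst hj)
      (Subtype.map_injective _ Function.injective_id)
  -- A model of `B`: the sorted bars counted by `h`, together with the bar `U`, which is present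
  -- only if it is nonempty.
  let L : Fin (h 0) ⊕ {_u : Unit // (0 : ℝ≥0) ∈ U} → LowerSet ℝ≥0 :=
    Sum.elim (fun k => ⟨{t | (k : ℕ) < h t}, fun _ _ hts ht => lt_of_lt_of_le ht (hh hts)⟩)
      fun _ => U
  have hLl : ∀ k t, t ∈ L (Sum.inl k) ↔ (k : ℕ) < h t := fun _ _ => Iff.rfl
  have hLr : ∀ u t, t ∈ L (Sum.inr u) ↔ t ∈ U := fun _ _ => Iff.rfl
  obtain ⟨e, he⟩ := exists_equiv_of_card_eq hB.lowerSet L hB.zero_mem (by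
    rintro (k | u)
    · exact k.2
    · exact u.2) (fun t => by
      rw [card_subtype_sum]
      simp only [hLl, hLr]
      rw [card_fin_lt (hh zero_le)]
      refine (hB.card t).trans ?_
      by_cases ht : t ∈ U
      · rw [hfU t ht]
        have : Unique {x : {_u : Unit // (0 : ℝ≥0) ∈ U} // t ∈ U} :=
          ⟨⟨⟨⟨(), U.lower zero_le ht⟩, ht⟩⟩, fun _ => rfl⟩
        rw [Nat.card_unique]
      · rw [hfU' t ht]
        have : IsEmpty {x : {_u : Unit // (0 : ℝ≥0) ∈ U} // t ∈ U} := ⟨fun x => ht x.2⟩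
        rw [Nat.card_of_isEmpty, add_zero])
  obtain ⟨e', he'⟩ := exists_sorted hC.lowerSet hC.zero_mem hC.card
  -- The `k`-th longest bar of `h` is matched with the `k`-th longest bar of `C`; `U` and the bars
  -- of `C` of rank at least `h 0` stay unmatched.
  let γ : Fin (h 0) ⊕ {_u : Unit // (0 : ℝ≥0) ∈ U} ≃. Fin (g 0) :=
    { toFun := Sum.elim (fun k => some (Fin.castLE (hg 0) k)) fun _ => none
      invFun := fun j => if hj : (j : ℕ) < h 0 then some (Sum.inl ⟨j, hj⟩) else none
      inv := by
        rintro (k | u) j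
        · by_cases hj : (j : ℕ) < h 0
          · simp only [hj, dite_true, Sum.elim_inl, Option.some.injEq,
              Sum.inl.injEq, Fin.ext_iff, Fin.val_castLE]
            exact eq_comm
          · simp only [hj, dite_false, Sum.elim_inl, Option.some.injEq,
              Fin.ext_iff, Fin.val_castLE, reduceCtorEq, false_iff]
            have := k.2
            omega
        · by_cases hj : (j : ℕ) < h 0 <;> simp [hj] }
  let γ' : B.Feature ≃. C.Feature := (e.toPEquiv.trans γ).trans e'.toPEquiv
  have hγ' : ∀ i, γ' i = (γ (e i)).map e' := by
    intro i
    simp only [γ', PEquiv.trans, Equiv.toPEquiv, PEquiv.coe_mk]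
    cases h : γ (e i) <;> simp [h]
  have hγs : ∀ j, γ'.symm j = (γ.symm (e'.symm j)).map e.symm := by
    intro j
    cases hj : γ.symm (e'.symm j) with
    | none =>
      cases hi : γ'.symm j with
      | none => rfl
      | some i =>
        have h1 : γ' i = some j := (PEquiv.eq_some_iff γ').1 hi
        rw [hγ'] at h1
        obtain ⟨x, hx, hxj⟩ := Option.map_eq_some_iff.1 h1
        have h2 := (PEquiv.eq_some_iff γ).2 hx
        rw [← hxj, Equiv.symm_apply_apply, h2] at hj
        simp at hj
    | some x =>
      have h1 := (PEquiv.eq_some_iff γ).1 hj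
      refine (PEquiv.eq_some_iff γ').2 ?_
      rw [hγ', Equiv.apply_symm_apply, h1]
      simp
  refine (iInf_le _ γ').trans (max_le (iSup_le fun i => iSup_le fun j => iSup_le fun hij => ?_)
    (max_le (iSup_le fun i => iSup_le fun hi => ?_) (iSup_le fun j => iSup_le fun hj => ?_)))
  · rw [hγ'] at hij
    have hi := he i
    cases hei : e i with
    | inr u =>
      rw [hei] at hij
      exact absurd hij (by simp [γ])
    | inl k =>
      rw [hei] at hij hi
      obtain rfl : e' (Fin.castLE (hg 0) k) = j := by
        simpa [γ] using hij
      have hj := he' (Fin.castLE (hg 0) k)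
      refine (hB.pairCost_le hC (fun t ht => (hj t).2 ?_) fun t ht => (hi t).1 ?_).trans
        (le_max_left _ _)
      · exact lt_of_lt_of_le ((hLl k t).1 ((hi t).2 ht)) (hg t)
      · exact lt_of_lt_of_le ((hj _).1 ht) (hgd t)
  · rw [hγ'] at hi
    have hi' := he i
    cases hei : e i with
    | inl k =>
      rw [hei] at hi
      exact absurd hi (by simp [γ])
    | inr u =>
      rw [hei] at hi'
      exact (B.diagonalCost_le i fun t ht => hU t ((hi' t).2 ht)).trans (le_max_right _ _)
  · rw [hγs, Option.map_eq_none_iff] at hj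
    have hj' := he' (e'.symm j)
    rw [Equiv.apply_symm_apply] at hj'
    have hlt : ¬ ((e'.symm j : Fin (g 0)) : ℕ) < h 0 := by
      intro hlt
      have : γ.symm (e'.symm j) = some (Sum.inl ⟨_, hlt⟩) := dif_pos hlt
      rw [this] at hj
      simp at hj
    refine (C.diagonalCost_le (m := d) j fun t ht => ?_).trans
      (le_max_of_le_left ENNReal.half_le_self)
    -- A bar of `C` of rank at least `h 0` is dead after time `d`, because `g d ≤ h 0`.
    by_contra htd
    have h1 := (hj' t).1 ht
    have h2 := hgd 0
    have h3 := hganti (not_le.1 htd).le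
    rw [zero_add] at h2
    omega

end Barcode

/-! ## Path homology in low degrees -/

namespace PathHomology

universe u

variable {V : Type u} {W : Type*}

instance [Finite V] (p : ℕ) : FiniteDimensional ℝ (Chain V p) :=
  Module.Finite.of_basis (pathBasis V p)

theorem mem_allowedChains_iff {D : Digraph V} {p : ℕ} {x : Chain V p} :
    x ∈ allowedChains D p ↔ ∀ v, ¬ IsAllowedPath D v → (pathBasis V p).repr x v = 0 := by
  have h : {x | ∃ v, IsAllowedPath D v ∧ x = pathBasis V p v} =
      pathBasis V p '' {v | IsAllowedPath D v} := by
    ext x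
    exact exists_congr fun v => and_congr_right fun _ => eq_comm
  rw [allowedChains, h, (pathBasis V p).mem_span_image]
  exact forall_congr' fun v => by rw [Finset.mem_coe, Finsupp.mem_support_iff, not_imp_comm]; rfl

theorem allowedChains_zero (D : Digraph V) : allowedChains D 0 = ⊤ :=
  eq_top_iff.2 fun _ _ => mem_allowedChains_iff.2 fun _ hv => absurd (fun i => i.elim0) hv

theorem invariantChains_one (D : Digraph V) : invariantChains D 1 = allowedChains D 1 := by
  rw [invariantChains, allowedChains_zero, Submodule.comap_top, inf_top_eq]

theorem isAllowedPath_one {D : Digraph V} {v : Fin 2 → V} :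
    IsAllowedPath D (p := 1) v ↔ D.Adj (v 0) (v 1) := by
  simp [IsAllowedPath]

theorem isAllowedPath_two {D : Digraph V} {v : Fin 3 → V} :
    IsAllowedPath D (p := 2) v ↔ D.Adj (v 0) (v 1) ∧ D.Adj (v 1) (v 2) := by
  simp [IsAllowedPath, Fin.forall_fin_two]

theorem isRegularPath_one {v : Fin 2 → V} : IsRegularPath (p := 1) v ↔ v 0 ≠ v 1 := by
  simp [IsRegularPath]

theorem isRegularPath_two {v : Fin 3 → V} :
    IsRegularPath (p := 2) v ↔ v 0 ≠ v 1 ∧ v 1 ≠ v 2 := by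
  simp [IsRegularPath, Fin.forall_fin_two]

theorem regularProj_of_regular {p : ℕ} {v : Fin (p + 1) → V} (h : IsRegularPath v) :
    regularProj V p (pathBasis V p v) = pathBasis V p v := by
  rw [regularProj, Module.Basis.constr_basis, if_pos h]

theorem regularProj_of_not_regular {p : ℕ} {v : Fin (p + 1) → V} (h : ¬ IsRegularPath v) :
    regularProj V p (pathBasis V p v) = 0 := by
  rw [regularProj, Module.Basis.constr_basis, if_neg h]

/-- The regular `1`-chain of a pair of vertices; it is `0` if the vertices agree. -/
noncomputable def edgeChain (u v : V) : Chain V 1 := regularProj V 1 (pathBasis V 1 ![u, v])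

theorem edgeChain_self (u : V) : edgeChain u u = 0 :=
  regularProj_of_not_regular fun h => isRegularPath_one.1 h rfl

theorem edgeChain_of_ne {u v : V} (h : u ≠ v) : edgeChain u v = pathBasis V 1 ![u, v] :=
  regularProj_of_regular (isRegularPath_one.2 h)

theorem eq_vec_two (v : Fin 2 → V) : v = ![v 0, v 1] := by
  ext i; fin_cases i <;> rfl

theorem edgeChain_mem {D : Digraph V} {u v : V} (h : u ≠ v → D.Adj u v) :
    edgeChain u v ∈ allowedChains D 1 := by
  by_cases huv : u = v
  · rw [huv, edgeChain_self]
    exact Submodule.zero_mem _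
  · rw [edgeChain_of_ne huv]
    exact Submodule.subset_span ⟨_, isAllowedPath_one.2 (h huv), rfl⟩

theorem boundary_zero_pathBasis (v : Fin 2 → V) :
    boundary V 0 (pathBasis V 1 v) = pathBasis V 0 ![v 1] - pathBasis V 0 ![v 0] := by
  have h : ∀ w, regularProj V 0 (pathBasis V 0 w) = pathBasis V 0 w := fun w =>
    regularProj_of_regular fun i => i.elim0
  have h0 : (fun k : Fin 1 => v (Fin.succAbove 0 k)) = ![v 1] := by
    ext k; fin_cases k; rfl
  have h1 : (fun k : Fin 1 => v (Fin.succAbove 1 k)) = ![v 0] := by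
    ext k; fin_cases k; rfl
  rw [boundary, LinearMap.comp_apply, nonregularBoundary, Module.Basis.constr_basis,
    Fin.sum_univ_two, h0, h1]
  simp only [map_add, map_smul, h]
  simp [sub_eq_add_neg]

theorem boundary_one_pathBasis (v : Fin 3 → V) :
    boundary V 1 (pathBasis V 2 v) =
      edgeChain (v 1) (v 2) - edgeChain (v 0) (v 2) + edgeChain (v 0) (v 1) := by
  have h0 : (fun k : Fin 2 => v (Fin.succAbove 0 k)) = ![v 1, v 2] := by
    ext k; fin_cases k <;> rfl
  have h1 : (fun k : Fin 2 => v (Fin.succAbove 1 k)) = ![v 0, v 2] := by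
    ext k; fin_cases k <;> rfl
  have h2 : (fun k : Fin 2 => v (Fin.succAbove 2 k)) = ![v 0, v 1] := by
    ext k; fin_cases k <;> rfl
  rw [boundary, LinearMap.comp_apply, nonregularBoundary, Module.Basis.constr_basis,
    Fin.sum_univ_three, h0, h1, h2]
  simp only [map_add, map_smul]
  simp [sub_eq_add_neg, edgeChain]

theorem boundary_edgeChain (u v : V) :
    boundary V 0 (edgeChain u v) = pathBasis V 0 ![v] - pathBasis V 0 ![u] := by
  by_cases h : u = v
  · rw [h, edgeChain_self, map_zero, sub_self]
  · rw [edgeChain_of_ne h, boundary_zero_pathBasis]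
    rfl

theorem boundary_boundary (x : Chain V 2) : boundary V 0 (boundary V 1 x) = 0 := by
  have h : boundary V 0 ∘ₗ boundary V 1 = 0 := (pathBasis V 2).ext fun v => by
    rw [LinearMap.comp_apply, boundary_one_pathBasis, map_add, map_sub, boundary_edgeChain,
      boundary_edgeChain, boundary_edgeChain, LinearMap.zero_apply]
    abel
  exact LinearMap.congr_fun h x

/-! ### Functoriality of regular chains and chain homotopies -/

/-- The map of regular chains induced by a map of vertices. -/
noncomputable def pushforward (φ : V → W) (p : ℕ) : Chain V p →ₗ[ℝ] Chain W p :=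
  (pathBasis V p).constr ℝ fun v => regularProj W p (pathBasis W p (φ ∘ v))

theorem pushforward_pathBasis (φ : V → W) (p : ℕ) (v : Fin (p + 1) → V) :
    pushforward φ p (pathBasis V p v) = regularProj W p (pathBasis W p (φ ∘ v)) :=
  Module.Basis.constr_basis _ _ _ _

theorem pushforward_one_pathBasis (φ : V → W) (v : Fin 2 → V) :
    pushforward φ 1 (pathBasis V 1 v) = edgeChain (φ (v 0)) (φ (v 1)) := by
  rw [pushforward_pathBasis, eq_vec_two (φ ∘ v)]
  rfl

theorem pushforward_edgeChain (φ : V → W) (u v : V) :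
    pushforward φ 1 (edgeChain u v) = edgeChain (φ u) (φ v) := by
  by_cases h : u = v
  · rw [h, edgeChain_self, edgeChain_self, map_zero]
  · rw [edgeChain_of_ne h, pushforward_one_pathBasis]
    rfl

/-- The delicate case is a path whose image is not regular: its pushforward is 0, and in the
pushed-forward boundary the collapsed edge vanishes while the other two faces cancel. -/
theorem boundary_pushforward (φ : V → W) (x : Chain V 2) :
    boundary W 1 (pushforward φ 2 x) = pushforward φ 1 (boundary V 1 x) := by
  have h : boundary W 1 ∘ₗ pushforward φ 2 = pushforward φ 1 ∘ₗ boundary V 1 :=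
    (pathBasis V 2).ext fun v => by
      rw [LinearMap.comp_apply, LinearMap.comp_apply, boundary_one_pathBasis,
        pushforward_pathBasis, map_add, map_sub, pushforward_edgeChain, pushforward_edgeChain,
        pushforward_edgeChain]
      by_cases hr : IsRegularPath (p := 2) (φ ∘ v)
      · rw [regularProj_of_regular hr, boundary_one_pathBasis]
        rfl
      · rw [regularProj_of_not_regular hr, map_zero]
        rw [isRegularPath_two, not_and_or, not_not, not_not] at hr
        simp only [Function.comp_apply] at hr
        rcases hr with hr | hr <;> rw [hr, edgeChain_self] <;> abel
  exact LinearMap.congr_fun h x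

theorem pushforward_mem_allowedChains {D : Digraph V} {D' : Digraph W} {φ : V → W}
    (hφ : ∀ u v, D.Adj u v → φ u ≠ φ v → D'.Adj (φ u) (φ v)) {p : ℕ} {x : Chain V p}
    (hx : x ∈ allowedChains D p) : pushforward φ p x ∈ allowedChains D' p := by
  refine Submodule.mem_comap.1
    ((Submodule.span_le (p := (allowedChains D' p).comap (pushforward φ p))).2 ?_ hx)
  rintro _ ⟨v, hv, rfl⟩
  rw [SetLike.mem_coe, Submodule.mem_comap, pushforward_pathBasis]
  by_cases hr : IsRegularPath (φ ∘ v)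
  · rw [regularProj_of_regular hr]
    exact Submodule.subset_span ⟨_, fun i => hφ _ _ (hv i) (hr i), rfl⟩
  · rw [regularProj_of_not_regular hr]
    exact Submodule.zero_mem _

theorem pushforward_mem_boundaries {D : Digraph V} {D' : Digraph W} {φ : V → W}
    (hφ : ∀ u v, D.Adj u v → φ u ≠ φ v → D'.Adj (φ u) (φ v)) {x : Chain V 1}
    (hx : x ∈ (invariantChains D 2).map (boundary V 1)) :
    pushforward φ 1 x ∈ (invariantChains D' 2).map (boundary W 1) := by
  obtain ⟨y, ⟨hy, hy'⟩, rfl⟩ := hx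
  refine ⟨pushforward φ 2 y, ⟨pushforward_mem_allowedChains hφ hy, ?_⟩, boundary_pushforward φ y⟩
  rw [SetLike.mem_coe, Submodule.mem_comap, boundary_pushforward]
  exact pushforward_mem_allowedChains hφ hy'

/-- A chain homotopy between the identity and the pushforward along `φ`, given on vertices, shows
that `φ` fixes all cycles. -/
theorem pushforward_eq_self {D : Digraph V} {φ : V → V} (κ : V → Chain V 1)
    (hκ : ∀ u v, D.Adj u v → κ v - κ u = edgeChain u v - edgeChain (φ u) (φ v))
    (hD : ∀ v, ¬ D.Adj v v) {x : Chain V 1} (hx : x ∈ allowedChains D 1)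
    (hx' : boundary V 0 x = 0) : pushforward φ 1 x = x := by
  let K : Chain V 0 →ₗ[ℝ] Chain V 1 := (pathBasis V 0).constr ℝ fun v => κ (v 0)
  have hK : ∀ v, K (pathBasis V 0 v) = κ (v 0) := fun v => Module.Basis.constr_basis _ _ _ _
  -- The homotopy identity has no degree-2 term, so a cycle equals its image exactly and not merely
  -- up to a boundary.
  have h : Set.EqOn (K ∘ₗ boundary V 0)
      (LinearMap.id - pushforward φ 1 : Chain V 1 →ₗ[ℝ] Chain V 1) (allowedChains D 1) := by
    refine LinearMap.eqOn_span ?_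
    rintro _ ⟨v, hv, rfl⟩
    have hadj := isAllowedPath_one.1 hv
    have hne : v 0 ≠ v 1 := fun h => hD (v 1) (by rwa [h] at hadj)
    rw [LinearMap.comp_apply, boundary_zero_pathBasis, map_sub, hK, hK, LinearMap.sub_apply,
      pushforward_one_pathBasis]
    refine (hκ _ _ hadj).trans ?_
    rw [edgeChain_of_ne hne, ← eq_vec_two v]
    rfl
  have h' := h hx
  rw [LinearMap.comp_apply, hx', map_zero] at h'
  exact (sub_eq_zero.1 h'.symm).symm

end PathHomology

/-! ## Walks and the shortest-path quasimetric -/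

namespace WeightedDigraph

open PathHomology

universe u

section Walk

variable {V : Type u} {G : WeightedDigraph V}

/-- `G.IsWalk i j r x`: there is a directed walk from `i` to `j`, of length `r`, the sum of whose
edges is the chain `x`. -/
inductive IsWalk (G : WeightedDigraph V) : V → V → ℝ → Chain V 1 → Prop
  | nil (i : V) : IsWalk G i i 0 0
  | cons {i j k : V} {r : ℝ} {x : Chain V 1} : G.Adj i j → IsWalk G j k r x →
      IsWalk G i k (G.weight i j + r) (edgeChain i j + x)

theorem IsWalk.nonneg {i j : V} {r : ℝ} {x : Chain V 1} (h : G.IsWalk i j r x) : 0 ≤ r := by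
  induction h with
  | nil => exact le_rfl
  | cons hij _ ih => exact add_nonneg (G.weight_nonneg _ _ hij) ih

theorem IsWalk.trans {i j k : V} {r s : ℝ} {x y : Chain V 1} (h : G.IsWalk i j r x)
    (h' : G.IsWalk j k s y) : G.IsWalk i k (r + s) (x + y) := by
  induction h with
  | nil => rwa [zero_add, zero_add]
  | cons hij _ ih =>
    rw [add_assoc, add_assoc]
    exact .cons hij (ih h')

theorem IsWalk.snoc {i j k : V} {r : ℝ} {x : Chain V 1} (h : G.IsWalk i j r x)
    (hjk : G.Adj j k) : G.IsWalk i k (r + G.weight j k) (x + edgeChain j k) := by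
  have := h.trans (.cons hjk (.nil k))
  rwa [add_zero, add_zero] at this

theorem IsWalk.mem_allowedChains {i j : V} {r : ℝ} {x : Chain V 1} (h : G.IsWalk i j r x) :
    x ∈ allowedChains G.toDigraph 1 := by
  induction h with
  | nil => exact Submodule.zero_mem _
  | cons hij _ ih => exact Submodule.add_mem _ (edgeChain_mem fun _ => hij) ih

theorem IsWalk.of_deleteEdge {u v i j : V} {r : ℝ} {x : Chain V 1}
    (h : (G.deleteEdge u v).IsWalk i j r x) : G.IsWalk i j r x := by
  induction h with
  | nil => exact .nil _
  | cons hij _ ih => exact .cons hij.1 ih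

theorem pathLength_le_append (s l : List V) (h : (s ++ l).IsChain G.Adj) :
    G.pathLength l ≤ G.pathLength (s ++ l) := by
  induction s with
  | nil => exact le_rfl
  | cons u s ih =>
    refine (ih h.tail).trans ?_
    rw [List.cons_append] at h ⊢
    cases hs : s ++ l with
    | nil => exact le_rfl
    | cons v t =>
      rw [hs] at h
      exact le_add_of_nonneg_left (G.weight_nonneg _ _ (List.isChain_cons_cons.1 h).1)

/-- Loop erasure: if the new initial vertex already occurs later, drop everything before that
occurrence. Nonnegative weights ensure that this does not increase the length. -/
theorem IsWalk.exists_isPath {i j : V} {r : ℝ} {x : Chain V 1} (h : G.IsWalk i j r x) :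
    ∃ l, G.IsPath i j l ∧ G.pathLength l ≤ r := by
  induction h with
  | nil i => exact ⟨[i], ⟨rfl, rfl, List.isChain_singleton _, List.nodup_singleton _⟩, le_rfl⟩
  | @cons i j k r x hij _ ih =>
    obtain ⟨l, ⟨hh, hl, hc, hn⟩, hlen⟩ := ih
    have hw := G.weight_nonneg _ _ hij
    obtain ⟨l', rfl⟩ : ∃ l', l = j :: l' := by
      cases l with
      | nil => simp at hh
      | cons v l' => exact ⟨l', by rw [Option.some.inj hh]⟩
    by_cases hi : i ∈ j :: l'
    · obtain ⟨s, t, hst⟩ := List.append_of_mem hi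
      rw [hst] at hl hc hn hlen
      refine ⟨i :: t, ⟨rfl, ?_, hc.right_of_append, (List.nodup_append.1 hn).2.1⟩, ?_⟩
      · rwa [List.getLast?_append_of_ne_nil _ (List.cons_ne_nil _ _)] at hl
      · exact ((pathLength_le_append _ _ hc).trans hlen).trans (le_add_of_nonneg_left hw)
    · refine ⟨i :: j :: l', ⟨rfl, ?_, List.isChain_cons_cons.2 ⟨hij, hc⟩,
        List.nodup_cons.2 ⟨hi, hn⟩⟩, ?_⟩
      · rwa [List.getLast?_cons_cons]
      · exact add_le_add_right hlen _

theorem IsWalk.dist_le {i j : V} {r : ℝ} {x : Chain V 1} (h : G.IsWalk i j r x) {t : ℝ≥0}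
    (hr : r ≤ t) : G.dist i j ≤ t := by
  obtain ⟨l, hl, hlen⟩ := h.exists_isPath
  refine (iInf₂_le l hl).trans ?_
  rw [← ENNReal.ofReal_coe_nnreal]
  exact ENNReal.ofReal_le_ofReal (hlen.trans hr)

theorem IsPath.exists_isWalk {i j : V} {l : List V} (h : G.IsPath i j l) :
    ∃ x, G.IsWalk i j (G.pathLength l) x := by
  obtain ⟨hh, hl, hc, -⟩ := h
  induction l generalizing i with
  | nil => simp at hh
  | cons u l ih =>
    obtain rfl : u = i := Option.some.inj hh
    cases l with
    | nil =>
      obtain rfl : u = j := by simpa using hl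
      exact ⟨0, .nil _⟩
    | cons v l =>
      obtain ⟨huv, hc'⟩ := List.isChain_cons_cons.1 hc
      rw [List.getLast?_cons_cons] at hl
      obtain ⟨x, hx⟩ := ih rfl hl hc'
      exact ⟨_, .cons huv hx⟩

/-- A finite vertex set carries finitely many paths without repetition, so the infimum defining the
distance is attained. -/
theorem exists_isWalk_of_dist_le [Finite V] {i j : V} {t : ℝ≥0} (h : G.dist i j ≤ t) :
    ∃ (r : ℝ) (x : Chain V 1), r ≤ t ∧ G.IsWalk i j r x := by
  classical
  have : Fintype V := Fintype.ofFinite V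
  have hfin : Finite {l // G.IsPath i j l} :=
    Finite.of_injective (fun l => (⟨l.1, l.2.2.2.2⟩ : {l : List V // l.Nodup}))
      fun l l' h => Subtype.ext (Subtype.mk.inj h)
  rw [dist, iInf_subtype'] at h
  cases isEmpty_or_nonempty {l // G.IsPath i j l} with
  | inl he =>
    rw [iInf_of_empty] at h
    exact absurd h (by simp)
  | inr hne =>
    obtain ⟨l, hl⟩ := exists_eq_ciInf_of_finite
      (f := fun l : {l // G.IsPath i j l} => ENNReal.ofReal (G.pathLength l.1))
    rw [← hl] at h
    obtain ⟨x, hx⟩ := l.2.exists_isWalk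
    refine ⟨G.pathLength l.1, x, ?_, hx⟩
    rwa [← ENNReal.ofReal_coe_nnreal, ENNReal.ofReal_le_ofReal_iff t.coe_nonneg] at h

theorem deleteEdge_dist_le (G : WeightedDigraph V) (x y i j : V) :
    G.dist i j ≤ (G.deleteEdge x y).dist i j := by
  have hlen : ∀ l, (G.deleteEdge x y).pathLength l = G.pathLength l := by
    intro l
    induction l with
    | nil => rfl
    | cons u l ih =>
      cases l with
      | nil => rfl
      | cons v l => exact congrArg (G.weight u v + ·) ih
  refine le_iInf₂ fun l hl => (iInf₂_le l ⟨hl.1, hl.2.1, ?_, hl.2.2.2⟩).trans_eq ?_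
  · rw [hlen]
  · exact hl.2.2.1.imp fun _ _ h => h.1

end Walk

/-! ## Grounded homology as a quotient of the cycle space -/

section Cycles

variable {V : Type u} (G : WeightedDigraph V)

/-- The directed cycle space of `G`. -/
noncomputable def cycles : Submodule ℝ (Chain V 1) :=
  allowedChains G.toDigraph 1 ⊓ LinearMap.ker (boundary V 0)

theorem cycles_le_groundedCycles (t : ℝ≥0) : G.cycles ≤ G.groundedCycles t := by
  refine inf_le_inf ?_ le_rfl
  rw [invariantChains_one]
  exact allowedChains_mono (D := G.toDigraph) (fun u v h => Or.inl h) 1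

theorem boundary_eq_zero_of_mem_groundedBoundaries {t : ℝ≥0} {x : Chain V 1}
    (hx : x ∈ G.groundedBoundaries t) : boundary V 0 x = 0 := by
  obtain ⟨y, -, rfl⟩ := hx
  exact boundary_boundary y

variable {G}

/-- All faces of the 2-path lie in `G^t`, which makes it ∂-invariant. The case `u = w` is included:
that face is then 0. -/
theorem triangle_mem_groundedBoundaries {t : ℝ≥0} {u v w : V} (huv : G.dist u v ≤ t)
    (hvw : G.dist v w ≤ t) (huw : G.dist u w ≤ t) :
    edgeChain u w - (edgeChain u v + edgeChain v w) ∈ G.groundedBoundaries t := by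
  by_cases h : u = v
  · rw [h, edgeChain_self, zero_add, sub_self]
    exact Submodule.zero_mem _
  by_cases h' : v = w
  · rw [h', edgeChain_self, add_zero, sub_self]
    exact Submodule.zero_mem _
  have hb := boundary_one_pathBasis ![u, v, w]
  have hb' : boundary V 1 (pathBasis V 2 ![u, v, w]) =
      edgeChain v w - edgeChain u w + edgeChain u v := hb
  refine ⟨-pathBasis V 2 ![u, v, w], ⟨?_, ?_⟩, ?_⟩
  · exact Submodule.neg_mem _ (Submodule.subset_span
      ⟨_, isAllowedPath_two.2 ⟨⟨h, huv⟩, ⟨h', hvw⟩⟩, rfl⟩)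
  · rw [SetLike.mem_coe, Submodule.mem_comap, map_neg, hb']
    exact Submodule.neg_mem _ (Submodule.add_mem _ (Submodule.sub_mem _
      (edgeChain_mem fun h => ⟨h, hvw⟩) (edgeChain_mem fun h => ⟨h, huw⟩))
      (edgeChain_mem fun h => ⟨h, huv⟩))
  · rw [map_neg, hb']
    abel

/-- The direct edge and the walk bound a fan of triangles with apex the final vertex. Every side of
the fan is spanned by a piece of the walk, hence has distance at most `t`. -/
theorem IsWalk.sub_mem_groundedBoundaries {t : ℝ≥0} {i j : V} {r : ℝ} {x : Chain V 1}
    (h : G.IsWalk i j r x) (hr : r ≤ t) : edgeChain i j - x ∈ G.groundedBoundaries t := by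
  induction h with
  | nil =>
    rw [edgeChain_self, sub_zero]
    exact Submodule.zero_mem _
  | @cons i j k r x hij hjk ih =>
    have h0 := G.weight_nonneg _ _ hij
    have h1 := hjk.nonneg
    have hsum := Submodule.add_mem _ (ih (by linarith))
      (triangle_mem_groundedBoundaries (G := G) (t := t) (u := i) (v := j) (w := k)
        ((IsWalk.cons hij (.nil j)).dist_le (by linarith)) (hjk.dist_le (by linarith))
        ((IsWalk.cons hij hjk).dist_le hr))
    have he : edgeChain i k - (edgeChain i j + x) =
        edgeChain j k - x + (edgeChain i k - (edgeChain i j + edgeChain j k)) := by abel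
    rwa [he]

/-- Replace each edge of `G^t` by a walk in `G` no longer than `t`. The correction is a boundary,
hence a cycle, so what remains is a cycle of `G`. -/
theorem groundedCycles_le [Finite V] (t : ℝ≥0) :
    G.groundedCycles t ≤ G.cycles ⊔ G.groundedBoundaries t := by
  have h : allowedChains (G.toDigraph ⊔ G.sublevel t) 1 ≤
      allowedChains G.toDigraph 1 ⊔ G.groundedBoundaries t := by
    refine Submodule.span_le.2 ?_
    rintro _ ⟨v, hv, rfl⟩
    rcases isAllowedPath_one.1 hv with hv | hv
    · exact Submodule.mem_sup_left (Submodule.subset_span ⟨v, isAllowedPath_one.2 hv, rfl⟩)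
    · obtain ⟨r, x, hr, hx⟩ := exists_isWalk_of_dist_le hv.2
      have h1 := hx.sub_mem_groundedBoundaries hr
      rw [edgeChain_of_ne hv.1, ← eq_vec_two v] at h1
      exact Submodule.mem_sup.2 ⟨x, hx.mem_allowedChains, _, h1, add_sub_cancel _ _⟩
  rintro z ⟨hz, hz'⟩
  rw [invariantChains_one] at hz
  obtain ⟨x, hx, y, hy, rfl⟩ := Submodule.mem_sup.1 (h hz)
  refine Submodule.mem_sup.2 ⟨x, ⟨hx, ?_⟩, y, hy, rfl⟩
  rwa [SetLike.mem_coe, LinearMap.mem_ker, map_add,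
    G.boundary_eq_zero_of_mem_groundedBoundaries hy, add_zero] at hz'

variable (G)

/-- All grounded homology classes are represented by cycles of the digraph itself. -/
noncomputable def cyclePresentation [Finite V] :
    G.groundedPersistentHomology.Presentation G.cycles where
  proj t := ((G.groundedBoundaries t).submoduleOf (G.groundedCycles t)).mkQ ∘ₗ
    Submodule.inclusion (G.cycles_le_groundedCycles t)
  surjective t := by
    intro q
    obtain ⟨z, rfl⟩ := Submodule.mkQ_surjective _ q
    obtain ⟨x, hx, y, hy, hxy⟩ := Submodule.mem_sup.1 (groundedCycles_le t z.2)
    refine ⟨⟨x, hx⟩, (Submodule.Quotient.eq _).2 ?_⟩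
    change x - z.1 ∈ G.groundedBoundaries t
    rw [← hxy, sub_add_cancel_left]
    exact Submodule.neg_mem _ hy
  map_proj _ _ := rfl

theorem finrank_groundedHomology [Finite V] (t : ℝ≥0) :
    Module.finrank ℝ (G.groundedPersistentHomology.space t) +
      Module.finrank ℝ (G.cycles ⊓ G.groundedBoundaries t : Submodule ℝ (Chain V 1)) =
      Module.finrank ℝ G.cycles := by
  let π := G.cyclePresentation
  have hker : LinearMap.ker (π.proj t) = (G.groundedBoundaries t).submoduleOf G.cycles := by
    ext x
    exact Submodule.Quotient.mk_eq_zero _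
  have h := LinearMap.finrank_range_add_finrank_ker (π.proj t)
  rw [LinearMap.range_eq_top.2 (π.surjective t), finrank_top, hker,
    ← Submodule.finrank_map_subtype_eq, Submodule.submoduleOf, Submodule.map_comap_subtype] at h
  exact h

theorem deleteEdge_groundedBoundaries_le (x y : V) (t : ℝ≥0) :
    (G.deleteEdge x y).groundedBoundaries t ≤ G.groundedBoundaries t :=
  Submodule.map_mono (invariantChains_mono (D := (G.deleteEdge x y).sublevel t)
    (D' := G.sublevel t) (fun u v h => ⟨h.1, (G.deleteEdge_dist_le x y u v).trans h.2⟩) 2)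

theorem deleteEdge_cycles (x y : V) :
    (G.deleteEdge x y).cycles = G.cycles ⊓ LinearMap.ker ((pathBasis V 1).coord ![x, y]) := by
  ext z
  simp only [cycles, Submodule.mem_inf, mem_allowedChains_iff, isAllowedPath_one,
    LinearMap.mem_ker, Module.Basis.coord_apply]
  constructor
  · rintro ⟨h, h'⟩
    exact ⟨⟨fun v hv => h v fun hv' => hv hv'.1, h'⟩, h _ fun hv => hv.2 rfl⟩
  · rintro ⟨⟨h, h'⟩, h''⟩
    refine ⟨fun v hv => ?_, h'⟩
    by_cases hxy : (v 0, v 1) = (x, y)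
    · rw [Prod.mk.injEq] at hxy
      rwa [eq_vec_two v, hxy.1, hxy.2]
    · exact h v fun hv' => hv ⟨hv', hxy⟩

theorem _root_.Submodule.finrank_inf_ker_of_le {N : Type*} [AddCommGroup N] [Module ℝ N]
    [FiniteDimensional ℝ N] (X : Submodule ℝ N) (l : N →ₗ[ℝ] ℝ) (h : ¬ X ≤ LinearMap.ker l) :
    Module.finrank ℝ (X ⊓ LinearMap.ker l : Submodule ℝ N) + 1 = Module.finrank ℝ X := by
  have h1 := LinearMap.finrank_range_add_finrank_ker (l ∘ₗ X.subtype)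
  have hne : l ∘ₗ X.subtype ≠ 0 := fun h0 => h fun x hx => LinearMap.congr_fun h0 ⟨x, hx⟩
  rw [LinearMap.range_eq_top.2 (LinearMap.surjective hne), finrank_top, Module.finrank_self,
    LinearMap.ker_comp, ← Submodule.finrank_map_subtype_eq, Submodule.map_comap_subtype] at h1
  omega

/-- Comparison of the barcodes of a weighted digraph and of the result of deleting an edge. -/
theorem bottleneckDist_deleteEdge_le [Finite V] (x y : V) {d m : ℝ≥0}
    (hd : ∀ t, ∀ z ∈ (G.deleteEdge x y).cycles, z ∈ G.groundedBoundaries t →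
      z ∈ (G.deleteEdge x y).groundedBoundaries (t + d))
    (hm : ∃ z ∈ G.cycles, z ∈ G.groundedBoundaries m ∧ (pathBasis V 1).coord ![x, y] z ≠ 0)
    {B C : Barcode} (hB : G.groundedPersistentHomology.HasBarcode B)
    (hC : (G.deleteEdge x y).groundedPersistentHomology.HasBarcode C) :
    Barcode.bottleneckDist B C ≤ max (d : ℝ≥0∞) (m / 2) := by
  let l := (pathBasis V 1).coord ![x, y]
  let Z := (G.deleteEdge x y).cycles
  -- The dimension of the image of `Z` in the homology of `G` at time `t`, intermediate between the
  -- two homologies.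
  let h : ℝ≥0 → ℕ := fun t => Module.finrank ℝ Z -
    Module.finrank ℝ (Z ⊓ G.groundedBoundaries t : Submodule ℝ (Chain V 1))
  -- The times at which no bounding cycle of `G` uses the deleted edge; during these the quotient
  -- has one dimension more than the image of `Z`.
  let U : LowerSet ℝ≥0 :=
    { carrier := {t | G.cycles ⊓ G.groundedBoundaries t ≤ LinearMap.ker l}
      lower' := fun s t hts hs => (inf_le_inf le_rfl (G.groundedBoundaries_mono hts)).trans hs }
  have hZ : Z = G.cycles ⊓ LinearMap.ker l := G.deleteEdge_cycles x y
  have hZB : ∀ t, Z ⊓ G.groundedBoundaries t =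
      (G.cycles ⊓ G.groundedBoundaries t) ⊓ LinearMap.ker l := fun t => by
    rw [hZ, inf_right_comm]
  have hle : ∀ t, Module.finrank ℝ (Z ⊓ G.groundedBoundaries t : Submodule ℝ (Chain V 1)) ≤
      Module.finrank ℝ Z := fun t => Submodule.finrank_mono inf_le_left
  obtain ⟨z, hz, hzm, hzl⟩ := hm
  have hZrank := G.cycles.finrank_inf_ker_of_le l fun hle => hzl (hle hz)
  rw [← hZ] at hZrank
  refine Barcode.bottleneckDist_le_of_isCounted (h := h) (G.cyclePresentation.isCounted hB)
    ((G.deleteEdge x y).cyclePresentation.isCounted hC) U (fun t ht => ?_) ?_ (fun t ht => ?_)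
    (fun t ht => ?_) (fun t => ?_) fun t => ?_
  · by_contra htm
    exact hzl (ht ⟨hz, G.groundedBoundaries_mono (not_le.1 htm).le hzm⟩)
  · exact fun s t hst => Nat.sub_le_sub_left
      (Submodule.finrank_mono (inf_le_inf le_rfl (G.groundedBoundaries_mono hst))) _
  · have h1 := G.finrank_groundedHomology t
    have h2 := hle t
    have h3 := hZB t
    have ht' : G.cycles ⊓ G.groundedBoundaries t ≤ LinearMap.ker l := ht
    rw [inf_eq_left.2 ht'] at h3
    simp only [h]
    rw [h3] at h2 ⊢
    omega
  · have h1 := G.finrank_groundedHomology t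
    have h2 := hle t
    have h3 := (G.cycles ⊓ G.groundedBoundaries t).finrank_inf_ker_of_le l ht
    rw [← hZB] at h3
    simp only [h]
    omega
  · have h1 := (G.deleteEdge x y).finrank_groundedHomology t
    have h2 : Module.finrank ℝ (Z ⊓ (G.deleteEdge x y).groundedBoundaries t :
        Submodule ℝ (Chain V 1)) ≤ _ := Submodule.finrank_mono
      (inf_le_inf (le_refl Z) (G.deleteEdge_groundedBoundaries_le x y t))
    simp only [h]
    change _ + Module.finrank ℝ (Z ⊓ _ : Submodule ℝ (Chain V 1)) = Module.finrank ℝ Z at h1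
    omega
  · have h1 := (G.deleteEdge x y).finrank_groundedHomology (t + d)
    have h2 : Module.finrank ℝ (Z ⊓ G.groundedBoundaries t : Submodule ℝ (Chain V 1)) ≤
        Module.finrank ℝ (Z ⊓ (G.deleteEdge x y).groundedBoundaries (t + d) :
          Submodule ℝ (Chain V 1)) :=
      Submodule.finrank_mono fun z hz => ⟨hz.1, hd t z hz.1 hz.2⟩
    simp only [h]
    change _ + Module.finrank ℝ (Z ⊓ _ : Submodule ℝ (Chain V 1)) = Module.finrank ℝ Z at h1
    omega

end Cycles

end WeightedDigraph

/-! ## The retraction of a subdivided edge -/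

namespace WeightedDigraph

open PathHomology

universe u

section Retraction

variable {V : Type u}

/-- The motive depends on both the index and the vertex, so that one case split evaluates
`subdivVertex` and locates the index. -/
theorem subdivVertex_cases (a b : V) {n : ℕ} {motive : Fin (n + 2) → V ⊕ Fin n → Prop}
    (zero : motive 0 (Sum.inl a)) (last : motive (Fin.last (n + 1)) (Sum.inl b))
    (new : ∀ k : Fin n, motive k.castSucc.succ (Sum.inr k)) (m : Fin (n + 2)) :
    motive m (subdivVertex a b n m) := by
  induction m using Fin.cases with
  | zero => exact zero
  | succ m =>
    induction m using Fin.lastCases with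
    | last =>
      rw [Fin.succ_last, subdivVertex_last]
      exact last
    | cast k =>
      rw [subdivVertex_new]
      exact new k

theorem eq_of_subdivVertex_eq_inl (a b u v : V) {n : ℕ} (i : Fin (n + 1))
    (hu : subdivVertex a b n i.castSucc = Sum.inl u)
    (hv : subdivVertex a b n i.succ = Sum.inl v) : (u, v) = (a, b) := by
  have h1 : ∀ m : Fin (n + 2), subdivVertex a b n m = Sum.inl u →
      m ≠ Fin.last (n + 1) → a = u := fun m => by
    refine subdivVertex_cases a b (motive := fun m x => x = Sum.inl u → m ≠ Fin.last (n + 1) →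
      a = u) (fun h _ => Sum.inl.inj h) (fun _ h => absurd rfl h) (fun k h => by simp at h) m
  have h2 : ∀ m : Fin (n + 2), subdivVertex a b n m = Sum.inl v → m ≠ 0 → b = v := fun m => by
    refine subdivVertex_cases a b (motive := fun m x => x = Sum.inl v → m ≠ 0 →
      b = v) (fun _ h => absurd rfl h) (fun h _ => Sum.inl.inj h) (fun k h => by simp at h) m
  rw [h1 _ hu (Fin.castSucc_ne_last i), h2 _ hv (Fin.succ_ne_zero i)]

/-- The retraction onto `V` of the subdivided edge `(a, b)` with the daughter `τ_i` removed: the new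
vertices before `τ_i` are sent to `a`, those after `τ_i` to `b`. -/
def retract (a b : V) {n : ℕ} (i : Fin (n + 1)) : V ⊕ Fin n → V :=
  Sum.elim id fun k => if k.castSucc.succ ≤ i.castSucc then a else b

theorem retract_subdivVertex (a b : V) {n : ℕ} (i : Fin (n + 1)) (m : Fin (n + 2)) :
    retract a b i (subdivVertex a b n m) = if m ≤ i.castSucc then a else b :=
  subdivVertex_cases a b (motive := fun m x => retract a b i x = if m ≤ i.castSucc then a else b)
    (by rw [if_pos (Fin.zero_le _)]; rfl)
    (by rw [if_neg (not_le.2 (Fin.castSucc_lt_last i))]; rfl) (fun _ => rfl) m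

theorem sum_castSucc_lt_succ {M : Type*} [AddCommMonoid M] {n : ℕ} (f : Fin (n + 1) → M)
    (l : Fin (n + 1)) : ∑ j with j.castSucc < l.succ, f j =
      ∑ j with j.castSucc < l.castSucc, f j + f l := by
  have h : ({j | j.castSucc < l.succ} : Finset (Fin (n + 1))) =
      insert l ({j | j.castSucc < l.castSucc} : Finset (Fin (n + 1))) := by
    ext j
    simp only [Finset.mem_filter_univ, Finset.mem_insert, Fin.castSucc_lt_succ_iff,
      Fin.castSucc_lt_castSucc_iff]
    exact le_iff_eq_or_lt
  rw [h, Finset.sum_insert (by simp), add_comm]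

theorem sum_castSucc_lt_last {M : Type*} [AddCommMonoid M] {n : ℕ} (f : Fin (n + 1) → M) :
    ∑ j with j.castSucc < Fin.last (n + 1), f j = ∑ j, f j :=
  Finset.sum_congr (Finset.filter_true_of_mem fun j _ => Fin.castSucc_lt_last j) fun _ _ => rfl

/-- The `l`-th daughter edge, as a chain. -/
noncomputable def daughterChain (a b : V) {n : ℕ} (l : Fin (n + 1)) : Chain (V ⊕ Fin n) 1 :=
  edgeChain (subdivVertex a b n l.castSucc) (subdivVertex a b n l.succ)

/-- The chain which joins the `m`-th vertex of the subdivided edge to its retraction. -/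
noncomputable def retractChain (a b : V) {n : ℕ} (i : Fin (n + 1)) (m : Fin (n + 2)) :
    Chain (V ⊕ Fin n) 1 :=
  ∑ j with j.castSucc < m, daughterChain a b j -
    if m ≤ i.castSucc then 0 else ∑ j, daughterChain a b j

/-- The homotopy between the identity and the retraction, on vertices. -/
noncomputable def retractHomotopy (a b : V) {n : ℕ} (i : Fin (n + 1)) :
    V ⊕ Fin n → Chain (V ⊕ Fin n) 1 :=
  Sum.elim 0 fun k => retractChain a b i k.castSucc.succ

/-- The two descriptions agree at old vertices: the chain is an empty sum at `a`, and at `b` the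
full sum cancels against the correction. -/
theorem retractHomotopy_subdivVertex (a b : V) {n : ℕ} (i : Fin (n + 1)) (m : Fin (n + 2)) :
    retractHomotopy a b i (subdivVertex a b n m) = retractChain a b i m :=
  subdivVertex_cases a b (motive := fun m x => retractHomotopy a b i x = retractChain a b i m)
    (by
      rw [retractChain, if_pos (Fin.zero_le _), sub_zero]
      simp [retractHomotopy])
    (by
      rw [retractChain, if_neg (not_le.2 (Fin.castSucc_lt_last i)), sum_castSucc_lt_last,
        sub_self]
      rfl) (fun _ => rfl) m

variable {G : WeightedDigraph V} {a b : V} {hab : G.Adj a b} {n : ℕ}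
  {S : stdSimplex ℝ (Fin (n + 1))} {i : Fin (n + 1)}

/-- Only `τ_i` crosses the threshold; any other daughter has both ends on the same side of the gap.
-/
theorem retract_subdivVertex_succ {l : Fin (n + 1)} (hl : l ≠ i) :
    retract a b i (subdivVertex a b n l.castSucc) = retract a b i (subdivVertex a b n l.succ) := by
  have h : l.succ ≤ i.castSucc ↔ l.castSucc ≤ i.castSucc := by
    rw [Fin.succ_le_castSucc_iff, Fin.castSucc_le_castSucc_iff]
    exact ⟨le_of_lt, fun h => lt_of_le_of_ne h hl⟩
  simp only [retract_subdivVertex, h]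

/-- Old edges are fixed by the retraction, and the homotopy vanishes at their ends. A surviving
daughter is collapsed; the correction terms at its ends agree, so the difference of partial sums is
that daughter. -/
theorem retractHomotopy_sub {x y : V ⊕ Fin n}
    (h : ((G.subdivide hab S).deleteEdge (subdivVertex a b n i.castSucc)
      (subdivVertex a b n i.succ)).Adj x y) :
    retractHomotopy a b i y - retractHomotopy a b i x =
      edgeChain x y - edgeChain (Sum.inl (retract a b i x)) (Sum.inl (retract a b i y)) := by
  obtain ⟨h, hne⟩ := h
  cases h with
  | old u v huv _ =>
    rw [retract, retractHomotopy]
    simp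
  | daughter l =>
    have hl : l ≠ i := by
      rintro rfl
      exact hne rfl
    have h : l.succ ≤ i.castSucc ↔ l.castSucc ≤ i.castSucc := by
      rw [Fin.succ_le_castSucc_iff, Fin.castSucc_le_castSucc_iff]
      exact ⟨le_of_lt, fun h => lt_of_le_of_ne h hl⟩
    rw [retract_subdivVertex_succ hl, edgeChain_self, sub_zero, retractHomotopy_subdivVertex,
      retractHomotopy_subdivVertex, retractChain, retractChain, sum_castSucc_lt_succ]
    simp only [h]
    rw [sub_sub_sub_cancel_right, add_sub_cancel_left]
    rfl

theorem deleteEdge_subdivide_adj {u v : V} (h : (G.deleteEdge a b).Adj u v) :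
    ((G.subdivide hab S).deleteEdge (subdivVertex a b n i.castSucc)
      (subdivVertex a b n i.succ)).Adj (Sum.inl u) (Sum.inl v) := by
  refine ⟨.old u v h.1 h.2, fun he => h.2 ?_⟩
  rw [Prod.mk.injEq] at he
  exact eq_of_subdivVertex_eq_inl a b u v i he.1.symm he.2.symm

/-- Walks which avoid the edge `(a, b)` survive its subdivision and the deletion of a daughter. -/
theorem IsWalk.deleteEdge_subdivide {u v : V} {r : ℝ} {x : Chain V 1}
    (h : (G.deleteEdge a b).IsWalk u v r x) :
    ∃ y, ((G.subdivide hab S).deleteEdge (subdivVertex a b n i.castSucc)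
      (subdivVertex a b n i.succ)).IsWalk (Sum.inl u) (Sum.inl v) r y := by
  induction h with
  | nil => exact ⟨0, .nil _⟩
  | cons huv _ ih =>
    obtain ⟨y, hy⟩ := ih
    have h := IsWalk.cons (deleteEdge_subdivide_adj (hab := hab) (S := S) (i := i) huv) hy
    have hw : ((G.subdivide hab S).deleteEdge (subdivVertex a b n i.castSucc)
        (subdivVertex a b n i.succ)).weight (Sum.inl _) (Sum.inl _) = G.weight _ _ :=
      subdivWeight_old G a b n S.1 _ _ huv.2
    rw [hw] at h
    exact ⟨_, h⟩

/-- The retraction of a walk in the subdivided digraph either avoids the edge `(a, b)` or can be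
shortened so as to use it exactly once. -/
theorem IsWalk.retract {x y : V ⊕ Fin n} {r : ℝ} {c : Chain (V ⊕ Fin n) 1} (i : Fin (n + 1))
    (h : (G.subdivide hab S).IsWalk x y r c) :
    (∃ p c, p ≤ r ∧ (G.deleteEdge a b).IsWalk (retract a b i x) (retract a b i y) p c) ∨
    ∃ p c q c', p + q ≤ r ∧ (G.deleteEdge a b).IsWalk (retract a b i x) a p c ∧
      (G.deleteEdge a b).IsWalk b (retract a b i y) q c' := by
  induction h with
  | nil => exact Or.inl ⟨0, 0, le_rfl, .nil _⟩
  | @cons x x' y r c hxx' _ ih =>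
    have hw := (G.subdivide hab S).weight_nonneg _ _ hxx'
    cases hxx' with
    | old u v huv hne =>
      have hw' : (G.subdivide hab S).weight (Sum.inl u) (Sum.inl v) =
          (G.deleteEdge a b).weight u v := subdivWeight_old G a b n S.1 _ _ hne
      have huv' : (G.deleteEdge a b).Adj (WeightedDigraph.retract a b i (Sum.inl u))
        (WeightedDigraph.retract a b i (Sum.inl v)) := ⟨huv, hne⟩
      rcases ih with ⟨p, c, hp, h⟩ | ⟨p, c, q, c', hpq, h, h'⟩
      · refine Or.inl ⟨_, _, ?_, .cons huv' h⟩
        rw [hw']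
        exact add_le_add_right hp _
      · refine Or.inr ⟨_, _, q, c', ?_, .cons huv' h, h'⟩
        rw [hw', add_assoc]
        exact add_le_add_right hpq _
    | daughter l =>
      by_cases hl : l = i
      · have h1 : WeightedDigraph.retract a b i (subdivVertex a b n l.castSucc) = a := by
          rw [retract_subdivVertex, if_pos (by rw [hl])]
        have h2 : WeightedDigraph.retract a b i (subdivVertex a b n l.succ) = b := by
          rw [retract_subdivVertex, if_neg (by rw [hl]; exact not_le.2 (Fin.castSucc_lt_succ))]
        rw [h1]
        rw [h2] at ih
        -- On crossing `τ_i`, any later stretch leading back to `a` is discarded: only the part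
        -- before the first crossing and the part after the last one are kept.
        rcases ih with ⟨p, c, hp, h⟩ | ⟨p, c, q, c', hpq, h, h'⟩
        · exact Or.inr ⟨0, 0, p, c, by linarith, .nil a, h⟩
        · have := h.nonneg
          exact Or.inr ⟨0, 0, q, c', by linarith, .nil a, h'⟩
      · rw [retract_subdivVertex_succ hl]
        rcases ih with ⟨p, c, hp, h⟩ | ⟨p, c, q, c', hpq, h, h'⟩
        · exact Or.inl ⟨p, c, by linarith, h⟩
        · exact Or.inr ⟨p, c, q, c', by linarith, h, h'⟩

/-- A bypass of the edge `(a, b)` of length at most `d` bounds the distortion of the retraction. -/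
theorem dist_retract_le [Finite V] {d : ℝ≥0} (hd : (G.deleteEdge a b).dist a b ≤ d) {t : ℝ≥0}
    {x y : V ⊕ Fin n} (h : (G.subdivide hab S).dist x y ≤ t) :
    ((G.subdivide hab S).deleteEdge (subdivVertex a b n i.castSucc)
      (subdivVertex a b n i.succ)).dist (Sum.inl (retract a b i x)) (Sum.inl (retract a b i y)) ≤
      (t + d : ℝ≥0) := by
  obtain ⟨r, c, hr, hc⟩ := exists_isWalk_of_dist_le h
  obtain ⟨s, e, hs, he⟩ := exists_isWalk_of_dist_le hd
  have hd0 := d.coe_nonneg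
  rcases hc.retract i with ⟨p, c, hp, h⟩ | ⟨p, c, q, c', hpq, h, h'⟩
  · obtain ⟨y, hy⟩ := h.deleteEdge_subdivide (hab := hab) (S := S) (i := i)
    refine hy.dist_le ?_
    rw [NNReal.coe_add]
    linarith
  · obtain ⟨y, hy⟩ := (h.trans (he.trans h')).deleteEdge_subdivide (hab := hab) (S := S) (i := i)
    refine hy.dist_le ?_
    rw [NNReal.coe_add]
    linarith

/-- The retraction fixes `z`, yet pushes any filling of `z` at time `t` to a filling at time `t + d`
which does not need `τ_i`. -/
theorem mem_groundedBoundaries_deleteEdge [Finite V] {d : ℝ≥0}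
    (hd : (G.deleteEdge a b).dist a b ≤ d) (t : ℝ≥0) {z : Chain (V ⊕ Fin n) 1}
    (hz : z ∈ ((G.subdivide hab S).deleteEdge (subdivVertex a b n i.castSucc)
      (subdivVertex a b n i.succ)).cycles)
    (hzt : z ∈ (G.subdivide hab S).groundedBoundaries t) :
    z ∈ ((G.subdivide hab S).deleteEdge (subdivVertex a b n i.castSucc)
      (subdivVertex a b n i.succ)).groundedBoundaries (t + d) := by
  have h := pushforward_eq_self (φ := fun x => Sum.inl (retract a b i x)) (retractHomotopy a b i)
    (fun x y hxy => retractHomotopy_sub hxy) (WeightedDigraph.loopless _) hz.1 hz.2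
  rw [← h]
  exact pushforward_mem_boundaries (D := (G.subdivide hab S).sublevel t)
    (D' := ((G.subdivide hab S).deleteEdge (subdivVertex a b n i.castSucc)
      (subdivVertex a b n i.succ)).sublevel (t + d))
    (fun x y hxy hne => ⟨hne, dist_retract_le hd hxy.2⟩) hzt

/-! ### The cycle through the subdivided edge -/

/-- The walk along the daughter edges. -/
theorem isWalk_daughters (m : Fin (n + 2)) :
    (G.subdivide hab S).IsWalk (Sum.inl a) (subdivVertex a b n m)
      (∑ j with j.castSucc < m, S j * G.weight a b)
      (∑ j with j.castSucc < m, daughterChain a b j) := by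
  induction m using Fin.induction with
  | zero =>
    have h : ({j | j.castSucc < (0 : Fin (n + 2))} : Finset (Fin (n + 1))) = ∅ := by simp
    rw [h, Finset.sum_empty, Finset.sum_empty]
    exact .nil _
  | succ l ih =>
    rw [sum_castSucc_lt_succ, sum_castSucc_lt_succ]
    have h := ih.snoc (SubdivAdj.daughter l)
    have hw : (G.subdivide hab S).weight (subdivVertex a b n l.castSucc)
        (subdivVertex a b n l.succ) = S l * G.weight a b := subdivWeight_daughter G a b n S.1 l
    rwa [hw] at h

theorem isWalk_subdivided_edge :
    (G.subdivide hab S).IsWalk (Sum.inl a) (Sum.inl b) (G.weight a b)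
      (∑ j, daughterChain a b j) := by
  have h := isWalk_daughters (G := G) (hab := hab) (S := S) (Fin.last (n + 1))
  rw [sum_castSucc_lt_last, sum_castSucc_lt_last, subdivVertex_last, ← Finset.sum_mul] at h
  have hS : ∑ j, S j = 1 := S.2.2
  rwa [hS, one_mul] at h

/-- All daughters contribute nonnegatively and `τ_i` contributes 1. Positivity suffices and avoids
showing that the daughters are pairwise distinct. -/
theorem coord_daughterChain_pos (hab : G.Adj a b) (i : Fin (n + 1)) :
    0 < (pathBasis (V ⊕ Fin n) 1).coord
      ![subdivVertex a b n i.castSucc, subdivVertex a b n i.succ]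
      (∑ j, daughterChain a b j) := by
  have hne : ∀ j : Fin (n + 1), subdivVertex a b n j.castSucc ≠ subdivVertex a b n j.succ :=
    fun j => not_subdivAdj_self G hab n _ _ (.daughter j)
  rw [map_sum]
  refine Finset.sum_pos' (fun j _ => ?_) ⟨i, Finset.mem_univ i, ?_⟩
  · rw [daughterChain, edgeChain_of_ne (hne j), Module.Basis.coord_apply, Module.Basis.repr_self]
    exact Finsupp.single_nonneg.2 zero_le_one _
  · rw [daughterChain, edgeChain_of_ne (hne i), Module.Basis.coord_apply, Module.Basis.repr_self,
      Finsupp.single_eq_same]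
    exact one_pos

/-- The cycle formed by the subdivided edge and a bypass becomes a boundary once both are short. -/
theorem exists_cycle_mem_groundedBoundaries [Finite V] {m : ℝ≥0}
    (hd : (G.deleteEdge a b).dist a b ≤ m) (hm : G.weight a b ≤ m) :
    ∃ z ∈ (G.subdivide hab S).cycles, z ∈ (G.subdivide hab S).groundedBoundaries m ∧
      (pathBasis (V ⊕ Fin n) 1).coord
        ![subdivVertex a b n i.castSucc, subdivVertex a b n i.succ] z ≠ 0 := by
  obtain ⟨r, c, hr, hc⟩ := exists_isWalk_of_dist_le hd
  obtain ⟨y, hy⟩ := hc.deleteEdge_subdivide (hab := hab) (S := S) (i := i)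
  have hy' : (G.subdivide hab S).IsWalk (Sum.inl a) (Sum.inl b) r y :=
    hy.of_deleteEdge
  have hx := isWalk_subdivided_edge (G := G) (hab := hab) (S := S)
  -- Both walks are homologous at time `m` to the direct edge from `a` to `b`.
  have hB : ∑ j, daughterChain a b j - y ∈ (G.subdivide hab S).groundedBoundaries m := by
    have h := Submodule.sub_mem _ (hy'.sub_mem_groundedBoundaries hr)
      (hx.sub_mem_groundedBoundaries hm)
    rwa [sub_sub_sub_cancel_left] at h
  refine ⟨_, ⟨Submodule.sub_mem _ hx.mem_allowedChains hy'.mem_allowedChains,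
    boundary_eq_zero_of_mem_groundedBoundaries _ hB⟩, hB, ?_⟩
  -- The bypass avoids the daughter, so it cannot cancel the coefficient coming from the subdivided
  -- edge.
  have h0 := mem_allowedChains_iff.1 hy.mem_allowedChains
    ![subdivVertex a b n i.castSucc, subdivVertex a b n i.succ]
    fun h => (isAllowedPath_one.1 h).2 rfl
  rw [map_sub, Module.Basis.coord_apply _ _ y, h0, sub_zero]
  exact (coord_daughterChain_pos hab i).ne'

end Retraction

end WeightedDigraph

theorem mainTheorem9 {V : Type*} [Finite V] (G : WeightedDigraph V) (hG : G.IsPositive)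
    (a b : V) (hab : G.Adj a b) (n : ℕ) (S : stdSimplex ℝ (Fin (n + 1))) (i : Fin (n + 1)) :
    (∃ B : Barcode, (G.subdivide hab S).groundedPersistentHomology.HasBarcode B) ∧
    (∃ C : Barcode,
      ((G.subdivide hab S).deleteEdge (WeightedDigraph.subdivVertex a b n i.castSucc)
        (WeightedDigraph.subdivVertex a b n i.succ)).groundedPersistentHomology.HasBarcode C) ∧
    ∀ B C : Barcode,
      (G.subdivide hab S).groundedPersistentHomology.HasBarcode B →
      ((G.subdivide hab S).deleteEdge (WeightedDigraph.subdivVertex a b n i.castSucc)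
        (WeightedDigraph.subdivVertex a b n i.succ)).groundedPersistentHomology.HasBarcode C →
      Barcode.bottleneckDist B C ≤
        max ((G.deleteEdge a b).dist a b) (ENNReal.ofReal (G.weight a b / 2)) := by
  refine ⟨(WeightedDigraph.cyclePresentation _).exists_hasBarcode,
    (WeightedDigraph.cyclePresentation _).exists_hasBarcode, fun B C hB hC => ?_⟩
  by_cases htop : (G.deleteEdge a b).dist a b = ⊤
  · rw [htop, max_eq_left le_top]
    exact le_top
  lift (G.deleteEdge a b).dist a b to ℝ≥0 using htop with d hd
  let w : ℝ≥0 := ⟨G.weight a b, (hG a b hab).le⟩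
  -- The cycle bounds once both its bypass, of length at most `d`, and the subdivided edge, of
  -- length `w`, are short. The resulting term `max d w / 2` is absorbed by `max d (w / 2)`.
  refine ((G.subdivide hab S).bottleneckDist_deleteEdge_le _ _ (d := d) (m := max d w)
    (fun t z hz hzt => WeightedDigraph.mem_groundedBoundaries_deleteEdge hd.ge t hz hzt)
    (WeightedDigraph.exists_cycle_mem_groundedBoundaries
      (hd.ge.trans (ENNReal.coe_le_coe.2 (le_max_left d w))) (le_max_right d w)) hB hC).trans ?_
  have hw : ENNReal.ofReal (G.weight a b / 2) = (w : ℝ≥0∞) / 2 := by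
    rw [ENNReal.ofReal_div_of_pos two_pos, ENNReal.ofReal_ofNat]
    congr 1
    exact ENNReal.ofReal_coe_nnreal (p := w)
  rw [hw]
  refine max_le (le_max_left _ _) ?_
  rcases le_total d w with h | h
  · rw [max_eq_right h]
    exact le_max_right _ _
  · rw [max_eq_left h]
    exact le_max_of_le_left ENNReal.half_le_self
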